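/- **Setting.** LTL$_f$ formulas over input variables $\mathcal X$ and output variables $\mathcal Y$ (finite, disjoint) are built by $\varphi ::= A \mid \neg\varphi \mid \varphi\wedge\varphi \mid \circ\varphi \mid \varphi\,\mathcal U\,\varphi$ and interpreted on nonempty finite traces over $2^{\mathcal X}\times 2^{\mathcal Y}$ ($\circ$ is the strong next). An instance of *LTL$_f$ synthesis under unreliable input* consists of $\mathcal X,\mathcal Y$, a set $\mathcal X_{unr}\subseteq\mathcal X$ and formulas $\varphi_m,\varphi_b$. A strategy $\sigma:(2^{\mathcal X})^*\to 2^{\mathcal Y}$ solves it if for every $X_0,X_1,\dots\in 2^{\mathcal X}$ there is $k\in\mathbb N$ such that the trace $t=(X_0,Y_0),\dots,(X_k,Y_k)$ with $Y_i=\sigma(X_0,\dots,X_{i-1})$ satisfies $\varphi_m$, and every trace $t'$ that agrees with $t$ on all variables outside $\mathcal X_{unr}$ satisfies $\varphi_b$. The *direct automata technique* is the following algorithm. (1) Build a DFA $A_{\varphi_m}$ recognizing $\varphi_m$. (2) Build an NFA $A_{\neg\varphi_b}$ recognizing $\neg\varphi_b$. (3) Form its existential abstraction over $\mathcal X_{unr}$: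 the NFA with the same states, initial and final states and $\delta'(s,(X,Y))=\{s' \mid \exists X'.\ X'=X \text{ outside } \mathcal X_{unr},\ s'\in\delta(s,(X',Y))\}$. (4) Determinize it by the subset construction. (5) Complement the resulting DFA. (6) Form the synchronous product of the DFAs from (1) and (5). (7) Solve the resulting DFA game: find a strategy $\sigma$ such that for every input sequence the resulting play reaches a final state after some nonempty trace, given as a finite-state controller, or report that none exists. Automata are represented by explicit transition tables over the listed alphabet $2^{\mathcal X}\times2^{\mathcal Y}$. Programs work on binary trees, each elementary step being charged the size of the tree it is applied to (polynomially equivalent to Turing-machine time). Sizes are sizes of encodings. **Theorem.** The direct automata technique runs in 2EXPTIME in the worst case. More precisely, there are programs for the steps (1)–(7) and polynomials such that, with $p$ the polynomial of the respective item and $s$ the size of the encoded input of the respective step: * (1), from $\varphi_m$ and the numbers of input and output variables, takes time at most $2^{2^{p(s)}}$; * (2), from $\varphi_b$ and the numbers of input and output variables, takes time at most $2^{p(s)}$; * (4), the determinization of an NFA, takes time at most $2^{p(s)}$; * (3), (5), (6) and (7), that is, existential abstraction, complementation, synchronous product and solving the DFA game, take time at most $p(s)$; * the program composed of these programs according to (1)–(7)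 takes, on every instance of encoding size $s$, time at most $2^{2^{p(s)}}$, and returns a finite-state controller whose strategy solves the instance if the instance is solvable, and "unrealizable" otherwise. -/

import Mathlib

namespace UnreliableSynthesis

/-! ### LTLf -/

/-- Formulas of LTLf over the propositional variables `V`. -/
inductive LTLf (V : Type) : Type
  | var (A : V)
  | neg (φ : LTLf V)
  | and (φ ψ : LTLf V)
  | next (φ : LTLf V)
  | untl (φ ψ : LTLf V)

/-- Satisfaction `t, i ⊨ φ` on a finite trace. Positions are counted from `0`, so the last one is
`t.length - 1`. -/
def LTLf.Sat {V : Type} (t : List (V → Bool)) : ℕ → LTLf V → Prop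
  | i, .var A => ∃ a, t[i]? = some a ∧ a A = true
  | i, .neg φ => ¬ LTLf.Sat t i φ
  | i, .and φ ψ => LTLf.Sat t i φ ∧ LTLf.Sat t i ψ
  | i, .next φ => i + 1 < t.length ∧ LTLf.Sat t (i + 1) φ
  | i, .untl φ ψ => ∃ j, i ≤ j ∧ j < t.length ∧ LTLf.Sat t j ψ ∧
      ∀ k, i ≤ k → k < j → LTLf.Sat t k φ

/-- A letter of `2^𝒳 × 2^𝒴`, with `m` input variables and `n` output variables. -/
abbrev Letter (m n : ℕ) : Type := (Fin m → Bool) × (Fin n → Bool)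

/-- LTLf formulas over `m` input and `n` output variables. -/
abbrev Formula (m n : ℕ) : Type := LTLf (Fin m ⊕ Fin n)

/-- The trace `t` satisfies `φ`. -/
def Models {m n : ℕ} (t : List (Letter m n)) (φ : Formula m n) : Prop :=
  LTLf.Sat (t.map fun a => Sum.elim a.1 a.2) 0 φ

/-- `L` is the set of models of `φ`. Traces are nonempty, so the empty word is disregarded. -/
def Recognizes {m n : ℕ} (L : Language (Letter m n)) (φ : Formula m n) : Prop :=
  ∀ t : List (Letter m n), t ≠ [] → (t ∈ L ↔ Models t φ)

/-! ### Synthesis under unreliable input -/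

/-- The projection of a trace that removes the input variables in `U`. -/
def proj {m n : ℕ} (U : Finset (Fin m)) (t : List (Letter m n)) :
    List (({v // v ∉ U} → Bool) × (Fin n → Bool)) :=
  t.map fun a => (fun v => a.1 v, a.2)

/-- The expansion of a trace without the variables in `U`: all ways of adding values for them. -/
def expand {m n : ℕ} (U : Finset (Fin m))
    (s : List (({v // v ∉ U} → Bool) × (Fin n → Bool))) : Set (List (Letter m n)) :=
  {t | proj U t = s}

/-- `t ∼ t'` up to the variables in `U`. -/
def EquivOff {m n : ℕ} (U : Finset (Fin m)) (t t' : List (Letter m n)) : Prop :=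
  t ∈ expand U (proj U t')

/-- A strategy of the agent: a map `(2^𝒳)^* → 2^𝒴`. -/
abbrev Strategy (m n : ℕ) : Type := List (Fin m → Bool) → (Fin n → Bool)

/-- The trace `(X₀, Y₀), …, (X_k, Y_k)` with `Y_i = σ (X₀, …, X_{i-1})`. -/
def play {m n : ℕ} (σ : Strategy m n) (X : ℕ → (Fin m → Bool)) (k : ℕ) : List (Letter m n) :=
  (List.range (k + 1)).map fun i => (X i, σ ((List.range i).map X))

/-- An instance of LTLf synthesis under unreliable input. -/
structure Instance where
  /-- number of input variables -/
  m : ℕ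
  /-- number of output variables -/
  n : ℕ
  /-- the unreliable input variables; the other inputs are reliable -/
  unr : Finset (Fin m)
  /-- the main specification -/
  main : Formula m n
  /-- the backup specification -/
  backup : Formula m n

/-- The strategy `σ` solves LTLf synthesis under unreliable input. -/
def Instance.SolvedBy (I : Instance) (σ : Strategy I.m I.n) : Prop :=
  ∀ X : ℕ → (Fin I.m → Bool), ∃ k : ℕ,
    Models (play σ X k) I.main ∧
    ∀ t', EquivOff I.unr t' (play σ X k) → Models t' I.backup

/-! ### Automata and games -/

/-- The existential abstraction of an NFA over the input variables in `U`. -/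
def existsAbs {m n : ℕ} {S : Type} (U : Finset (Fin m)) (N : NFA (Letter m n) S) :
    NFA (Letter m n) S where
  step s a := {s' | ∃ X' : Fin m → Bool, (∀ v, v ∉ U → a.1 v = X' v) ∧ s' ∈ N.step s (X', a.2)}
  start := N.start
  accept := N.accept

/-- `σ` is a winning strategy of the agent in the DFA game `G`: whatever the inputs, the play
reaches a final state after some nonempty trace. -/
def Wins {m n : ℕ} {S : Type} (G : DFA (Letter m n) S) (σ : Strategy m n) : Prop :=
  ∀ X : ℕ → (Fin m → Bool), ∃ k : ℕ, G.eval (play σ X k) ∈ G.accept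

/-- A finite-state (Moore) controller, the finite representation of a strategy. -/
structure Controller (m n : ℕ) where
  states : ℕ
  start : Fin states
  step : Fin states → (Fin m → Bool) → Fin states
  out : Fin states → (Fin n → Bool)

/-- The strategy implemented by a controller. -/
def Controller.strategy {m n : ℕ} (C : Controller m n) : Strategy m n :=
  fun w => C.out (w.foldl C.step C.start)

/-! ### Programs, their semantics and their running time

Data are binary trees. A program maps a tree to a tree, and every evaluation step is charged the
size of the tree it is applied to. Every step moves at most as much data as it is charged for, so
this measure and the running time of Turing machines are polynomially related. -/

inductive Data : Type
  | nil
  | cons (a b : Data)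

/-- Number of nodes. -/
def Data.size : Data → ℕ
  | .nil => 1
  | .cons a b => 1 + a.size + b.size

inductive Prog : Type
  /-- the constant `nil` -/
  | nil
  /-- the identity -/
  | id
  /-- first component -/
  | hd
  /-- second component -/
  | tl
  /-- equality test of the two components; `nil` is "false" -/
  | eq
  /-- run two programs on the same input and form the pair of the results -/
  | pair (p q : Prog)
  /-- run `p`, then run `q` on its result -/
  | seq (p q : Prog)
  /-- if `c` does not return `nil` run `p`, else run `q` -/
  | cond (c p q : Prog)
  /-- as long as `c` does not return `nil` replace the current value by its image under `p` -/
  | loop (c p : Prog)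

/-- `Prog.Runs p x y t`: on input `x` the program `p` halts with output `y` after time `t`. -/
inductive Prog.Runs : Prog → Data → Data → ℕ → Prop
  | nil (x : Data) : Runs .nil x .nil x.size
  | id (x : Data) : Runs .id x x x.size
  | hd_nil : Runs .hd .nil .nil (Data.size .nil)
  | hd_cons (a b : Data) : Runs .hd (.cons a b) a (Data.size (.cons a b))
  | tl_nil : Runs .tl .nil .nil (Data.size .nil)
  | tl_cons (a b : Data) : Runs .tl (.cons a b) b (Data.size (.cons a b))
  | eq_nil : Runs .eq .nil .nil (Data.size .nil)
  | eq_true (a : Data) : Runs .eq (.cons a a) (.cons .nil .nil) (Data.size (.cons a a))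
  | eq_false (a b : Data) (h : a ≠ b) : Runs .eq (.cons a b) .nil (Data.size (.cons a b))
  | pair {p q : Prog} {x y z : Data} {t₁ t₂ : ℕ} (h₁ : Runs p x y t₁) (h₂ : Runs q x z t₂) :
      Runs (.pair p q) x (.cons y z) (x.size + t₁ + t₂)
  | seq {p q : Prog} {x y z : Data} {t₁ t₂ : ℕ} (h₁ : Runs p x y t₁) (h₂ : Runs q y z t₂) :
      Runs (.seq p q) x z (x.size + t₁ + t₂)
  | cond_true {c p q : Prog} {x v y : Data} {t₁ t₂ : ℕ} (h₁ : Runs c x v t₁) (hv : v ≠ .nil)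
      (h₂ : Runs p x y t₂) : Runs (.cond c p q) x y (x.size + t₁ + t₂)
  | cond_false {c p q : Prog} {x y : Data} {t₁ t₂ : ℕ} (h₁ : Runs c x .nil t₁)
      (h₂ : Runs q x y t₂) : Runs (.cond c p q) x y (x.size + t₁ + t₂)
  | loop_stop {c p : Prog} {x : Data} {t : ℕ} (h : Runs c x .nil t) :
      Runs (.loop c p) x x (x.size + t)
  | loop_step {c p : Prog} {x v y z : Data} {t₁ t₂ t₃ : ℕ} (h₁ : Runs c x v t₁) (hv : v ≠ .nil)
      (h₂ : Runs p x y t₂) (h₃ : Runs (.loop c p) y z t₃) :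
      Runs (.loop c p) x z (x.size + t₁ + t₂ + t₃)

/-- On input `x` the program `p` halts with output `y` within time `T`. -/
def Prog.RunsWithin (p : Prog) (x y : Data) (T : ℕ) : Prop :=
  ∃ t, t ≤ T ∧ p.Runs x y t

/-! ### Encodings

Numbers are written in unary, subsets as characteristic vectors, and automata as explicit transition
tables over the listed alphabet. -/

def encNat : ℕ → Data
  | 0 => .nil
  | k + 1 => .cons .nil (encNat k)

def encBool (b : Bool) : Data := encNat b.toNat

def encList : List Data → Data
  | [] => .nil
  | d :: l => .cons d (encList l)

def encVal {k : ℕ} (v : Fin k → Bool) : Data := encList (List.ofFn fun i => encBool (v i))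

open Classical in
noncomputable def encSet {k : ℕ} (A : Set (Fin k)) : Data := encVal fun i => decide (i ∈ A)

/-- All of `2^𝒱` for `k` variables, in lexicographic order. -/
def allVals : (k : ℕ) → List (Fin k → Bool)
  | 0 => [Fin.elim0]
  | k + 1 => [false, true].flatMap fun b => (allVals k).map fun v => Fin.cons b v

/-- The alphabet `2^𝒳 × 2^𝒴`, in lexicographic order. -/
def allLetters (m n : ℕ) : List (Letter m n) := (allVals m).product (allVals n)

def encLetter {m n : ℕ} (a : Letter m n) : Data := .cons (encVal a.1) (encVal a.2)

def encFormula {m n : ℕ} : Formula m n → Data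
  | .var (.inl i) => .cons (encNat 0) (.cons (encNat 0) (encNat i))
  | .var (.inr j) => .cons (encNat 0) (.cons (encNat 1) (encNat j))
  | .neg φ => .cons (encNat 1) (encFormula φ)
  | .and φ ψ => .cons (encNat 2) (.cons (encFormula φ) (encFormula ψ))
  | .next φ => .cons (encNat 3) (encFormula φ)
  | .untl φ ψ => .cons (encNat 4) (.cons (encFormula φ) (encFormula ψ))

/-- A formula together with the numbers of input and output variables. -/
def encSpec {m n : ℕ} (φ : Formula m n) : Data :=
  .cons (encNat m) (.cons (encNat n) (encFormula φ))

noncomputable def encInstance (I : Instance) : Data :=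
  .cons (encNat I.m) (.cons (encNat I.n) (.cons (encSet (I.unr : Set (Fin I.m)))
    (.cons (encFormula I.main) (encFormula I.backup))))

/-- Alphabet, number of states, initial states, transition table, final states. -/
noncomputable def encNFA {m n k : ℕ} (N : NFA (Letter m n) (Fin k)) : Data :=
  encList [encList ((allLetters m n).map encLetter), encNat k, encSet N.start,
    encList (List.ofFn fun s => encList ((allLetters m n).map fun a => encSet (N.step s a))),
    encSet N.accept]

/-- Alphabet, number of states, initial state, transition table, final states. -/
noncomputable def encDFA {m n k : ℕ} (M : DFA (Letter m n) (Fin k)) : Data :=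
  encList [encList ((allLetters m n).map encLetter), encNat k, encNat M.start,
    encList (List.ofFn fun s => encList ((allLetters m n).map fun a => encNat (M.step s a))),
    encSet M.accept]

/-- Input alphabet, number of states, initial state, transition table, outputs. -/
def encController {m n : ℕ} (C : Controller m n) : Data :=
  encList [encList ((allVals m).map encVal), encNat C.states, encNat C.start,
    encList (List.ofFn fun s => encList ((allVals m).map fun X => encNat (C.step s X))),
    encList (List.ofFn fun s => encVal (C.out s))]

/-- The answer of a solver: a controller, or `none` for "unrealizable". -/
def encAnswer {m n : ℕ} : Option (Controller m n) → Data
  | none => .nil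
  | some C => .cons .nil (encController C)

/-! ### The direct automata technique -/

/-- The direct technique, assembled from programs for its stages. On an encoded instance: run
`mainDfa` on the main specification; run `backupNfa` on the backup specification, abstract the
unreliable inputs, determinize and complement; form the product of the two DFAs and solve the game
on it. -/
def directTechnique (mainDfa backupNfa abstr det compl prod solve : Prog) : Prog :=
  let nIn : Prog := .hd
  let nOut : Prog := .seq .tl .hd
  let unr : Prog := .seq .tl (.seq .tl .hd)
  let specs : Prog := .seq .tl (.seq .tl .tl)
  let main : Prog := .seq specs .hd
  let backup : Prog := .seq specs .tl
  let mainPart : Prog := .seq (.pair nIn (.pair nOut main)) mainDfa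
  let backupPart : Prog :=
    .seq (.pair unr (.seq (.pair nIn (.pair nOut backup)) backupNfa))
      (.seq abstr (.seq det compl))
  .seq (.pair mainPart backupPart) (.seq prod solve)

end UnreliableSynthesis

open UnreliableSynthesis

/-!
Every stage of the direct technique is first written as a function on lists, bits and numbers, and
the existence of a program with the required running time follows from closure properties.
`PolyTime f` says that some program computes `f`, on encoded arguments, within a polynomial time
bound. Polynomial time is closed under composition, pairing and case distinction, and under folds
over lists whose intermediate results stay polynomially large (`PolyTime.foldl`, from the loop rule
`Prog.RunsWithin.loop`). From folds one gets `map`, `flatMap`, `filter`, `zip`, `lookup`, `range`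
and arithmetic, and `fun_prop` combines these facts. `TimeIn B f` is the variant with time polynomial
in a given measure `B`; the only function that needs it genuinely is `allBits`, which lists the `2 ^ k`
bit lists of length `k` in time polynomial in `2 ^ k`. As the output of a program is no larger than
its running time, everything composes, and a polynomial in `2 ^ y` is at most `2 ^ (c * (y + 1))`.

An automaton is handled through its table: the letters, the number of states, the start, the
transition table and the final states. Existential abstraction, complementation and product are
direct constructions on tables; the subset construction numbers the sets of states by their
positions in `allBits k`.

The automaton for `¬φ` guesses, at every position of the trace, the truth values of all subformulas
of `φ` (`guessNFA`). A transition from the values `v` to the values `v'` under a letter is allowed if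
`v` is what the letter and `v'` dictate by the semantics of the connectives, where `○ψ` has the value
of `ψ` in `v'`, and `ψ U χ` unfolds to `χ ∨ (ψ ∧ ○(ψ U χ))`. Past the end of the trace all values are
false, which makes the next operator strong. Hence the values are determined backwards
from the end of the trace, a state accepts just the traces whose truth values it lists
(`mem_acceptsFrom_guessNFA`), and the initial states are those at which `φ` is false. The number of
states is exponential in the number of subformulas. A deterministic automaton for `φ` is obtained
by applying the subset construction to the automaton for `¬¬φ`.

The game is solved by the attractor computation: `attr G i` assigns an output to each state from
which a final state can be forced in at most `i` steps. With `k` states it is stable after `k`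
rounds. If the initial state is in the attractor, following the outputs decreases the
number of rounds until a final state is reached; otherwise the environment can always answer so that
the play remains outside the attractor.

Finally, the word produced by a play is accepted by the product game iff it satisfies the main
specification and no word that agrees with it on the reliable variables violates the backup
specification (`wins_iff_solvedBy`), and the running times of the stages add up to a doubly
exponential bound (`exists_directTechnique_bound`).
-/

namespace UnreliableSynthesis

open Polynomial

/-! ### Polynomial and exponential bounds -/

theorem eval_mono (P : ℕ[X]) {a b : ℕ} (h : a ≤ b) : P.eval a ≤ P.eval b := by
  induction P using Polynomial.induction_on' with
  | add p q hp hq => simpa using add_le_add hp hq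
  | monomial n c => simp only [eval_monomial]; gcongr

/-- A polynomial in an exponential is bounded by an exponential. -/
theorem exists_eval_two_pow_le (P : ℕ[X]) : ∃ c : ℕ, ∀ y, P.eval (2 ^ y) ≤ 2 ^ (c * (y + 1)) := by
  induction P using Polynomial.induction_on' with
  | add p q hp hq =>
    obtain ⟨a, ha⟩ := hp
    obtain ⟨b, hb⟩ := hq
    refine ⟨a + b + 1, fun y => ?_⟩
    rw [eval_add]
    have h₁ : p.eval (2 ^ y) ≤ 2 ^ ((a + b) * (y + 1)) :=
      (ha y).trans (Nat.pow_le_pow_right (by norm_num) (by gcongr; omega))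
    have h₂ : q.eval (2 ^ y) ≤ 2 ^ ((a + b) * (y + 1)) :=
      (hb y).trans (Nat.pow_le_pow_right (by norm_num) (by gcongr; omega))
    calc _ ≤ 2 ^ ((a + b) * (y + 1)) + 2 ^ ((a + b) * (y + 1)) := add_le_add h₁ h₂
      _ = 2 ^ ((a + b) * (y + 1) + 1) := by rw [pow_succ]; ring
      _ ≤ _ := Nat.pow_le_pow_right (by norm_num) (by nlinarith)
  | monomial n c =>
    refine ⟨c + n, fun y => ?_⟩
    rw [eval_monomial, ← pow_mul]
    calc c * 2 ^ (y * n) ≤ 2 ^ c * 2 ^ (y * n) := by gcongr; exact Nat.lt_two_pow_self.le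
      _ = 2 ^ (c + y * n) := by rw [pow_add]
      _ ≤ _ := Nat.pow_le_pow_right (by norm_num) (by nlinarith)

/-! ### Running times -/

theorem Data.size_pos (x : Data) : 0 < x.size := by cases x <;> simp only [Data.size] <;> omega

theorem Prog.RunsWithin.mono {p : Prog} {x y : Data} {s t : ℕ} (h : p.RunsWithin x y s)
    (hst : s ≤ t) : p.RunsWithin x y t :=
  let ⟨u, hu, hr⟩ := h
  ⟨u, hu.trans hst, hr⟩

/-- A program reads its whole input. -/
theorem Prog.Runs.size_le_input {p : Prog} {x y : Data} {t : ℕ} (h : p.Runs x y t) :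
    x.size ≤ t := by
  induction h <;> omega

theorem Prog.Runs.size_le_output {p : Prog} {x y : Data} {t : ℕ} (h : p.Runs x y t) :
    y.size ≤ t := by
  induction h <;> try simp only [Data.size] at *
  case eq_true a => have := a.size_pos; omega
  case pair x _ _ _ _ _ _ _ _ =>
    have := x.size_pos
    omega
  all_goals first | omega | exact Data.size_pos _

theorem Prog.RunsWithin.input_le {p : Prog} {x y : Data} {t : ℕ} (h : p.RunsWithin x y t) :
    x.size ≤ t :=
  let ⟨_, hu, hr⟩ := h
  hr.size_le_input.trans hu

/-- The output of a program is no larger than its running time. -/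
theorem Prog.RunsWithin.output_le {p : Prog} {x y : Data} {t : ℕ} (h : p.RunsWithin x y t) :
    y.size ≤ t :=
  let ⟨_, hu, hr⟩ := h
  hr.size_le_output.trans hu

theorem Prog.RunsWithin.seq {p q : Prog} {x y z : Data} {s t : ℕ} (h₁ : p.RunsWithin x y s)
    (h₂ : q.RunsWithin y z t) : (Prog.seq p q).RunsWithin x z (x.size + s + t) :=
  let ⟨_, hu, hr⟩ := h₁
  let ⟨_, hv, hs⟩ := h₂
  ⟨_, by omega, .seq hr hs⟩

theorem Prog.RunsWithin.pair {p q : Prog} {x y z : Data} {s t : ℕ} (h₁ : p.RunsWithin x y s)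
    (h₂ : q.RunsWithin x z t) : (Prog.pair p q).RunsWithin x (.cons y z) (x.size + s + t) :=
  let ⟨_, hu, hr⟩ := h₁
  let ⟨_, hv, hs⟩ := h₂
  ⟨_, by omega, .pair hr hs⟩

theorem Prog.RunsWithin.hd (a b : Data) :
    Prog.hd.RunsWithin (.cons a b) a (Data.cons a b).size := ⟨_, le_rfl, .hd_cons a b⟩

theorem Prog.RunsWithin.tl (a b : Data) :
    Prog.tl.RunsWithin (.cons a b) b (Data.cons a b).size := ⟨_, le_rfl, .tl_cons a b⟩

/-- A loop that runs through the values `s 0, …, s n`, where `T` bounds the time of each single test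
and of each single pass through the body. -/
theorem Prog.RunsWithin.loop {c p : Prog} (T : ℕ) (n : ℕ) : ∀ (s : ℕ → Data),
    (∀ i < n, ∃ v ≠ Data.nil, c.RunsWithin (s i) v T) → c.RunsWithin (s n) .nil T →
    (∀ i < n, p.RunsWithin (s i) (s (i + 1)) T) →
    (Prog.loop c p).RunsWithin (s 0) (s n) ((n + 1) * (3 * T)) := by
  induction n with
  | zero =>
    intro s _ hn _
    have := hn.input_le
    obtain ⟨t, ht, hr⟩ := hn
    exact ⟨_, by omega, Prog.Runs.loop_stop hr⟩
  | succ n ih =>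
    intro s hc hn hp
    obtain ⟨t, ht, hr⟩ := ih (fun i => s (i + 1)) (fun i hi => hc _ (by omega)) hn
      (fun i hi => hp _ (by omega))
    obtain ⟨v, hv, hcv⟩ := hc 0 (by omega)
    have := hcv.input_le
    obtain ⟨t₁, ht₁, hr₁⟩ := hcv
    obtain ⟨t₂, ht₂, hr₂⟩ := hp 0 (by omega)
    refine ⟨_, ?_, .loop_step hr₁ hv hr₂ hr⟩
    have : (n + 1 + 1) * (3 * T) = (n + 1) * (3 * T) + 3 * T := by ring
    omega

/-! ### Encodable types -/

/-- Types whose elements are represented by trees. -/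
class Enc (α : Type) where
  /-- the tree that represents an element -/
  enc : α → Data
  inj : Function.Injective enc

open Enc

variable {α β γ : Type} [Enc α] [Enc β] [Enc γ]

/-- The size of the encoding. -/
def esize (x : α) : ℕ := (enc x).size

theorem esize_pos (x : α) : 0 < esize x := Data.size_pos _

theorem encNat_injective : Function.Injective encNat := by
  intro a
  induction a with
  | zero => intro b h; cases b <;> simp_all [encNat]
  | succ a ih =>
    intro b h
    cases b with
    | zero => simp [encNat] at h
    | succ b => simp only [encNat, Data.cons.injEq, true_and] at h; rw [ih h]

theorem encList_injective : Function.Injective encList := by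
  intro a
  induction a with
  | nil => intro b h; cases b <;> simp_all [encList]
  | cons x a ih =>
    intro b h
    cases b with
    | nil => simp [encList] at h
    | cons y b => simp only [encList, Data.cons.injEq] at h; rw [h.1, ih h.2]

instance : Enc Data := ⟨id, Function.injective_id⟩

instance : Enc Unit := ⟨fun _ => .nil, fun _ _ _ => rfl⟩

instance : Enc Bool :=
  ⟨encBool, fun a b h => by
    have := encNat_injective h
    revert this; cases a <;> cases b <;> simp⟩

instance : Enc ℕ := ⟨encNat, encNat_injective⟩

instance : Enc (List α) :=
  ⟨fun l => encList (l.map enc), fun _ _ h => List.map_injective_iff.2 inj (encList_injective h)⟩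

instance : Enc (α × β) :=
  ⟨fun x => .cons (enc x.1) (enc x.2), fun x y h => by
    simp only [Data.cons.injEq] at h
    exact Prod.ext (inj h.1) (inj h.2)⟩

instance : Enc (Option α) :=
  ⟨fun o => o.elim .nil fun x => .cons .nil (enc x), fun x y h => by
    cases x <;> cases y <;> simp at h
    · rfl
    · rw [inj h]⟩

theorem enc_prod (a : α) (b : β) : enc (a, b) = .cons (enc a) (enc b) := rfl
theorem enc_cons (a : α) (l : List α) : enc (a :: l) = .cons (enc a) (enc l) := rfl
theorem enc_false : enc false = .nil := rfl
theorem enc_true : enc true = .cons .nil .nil := rfl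
theorem enc_some (a : α) : enc (some a) = .cons .nil (enc a) := rfl
theorem enc_succ (k : ℕ) : enc (k + 1) = .cons .nil (enc k) := rfl

@[simp] theorem esize_prod (a : α) (b : β) : esize (a, b) = 1 + esize a + esize b := rfl
@[simp] theorem esize_nil : esize ([] : List α) = 1 := rfl
@[simp] theorem esize_cons (a : α) (l : List α) : esize (a :: l) = 1 + esize a + esize l := rfl
@[simp] theorem esize_unit (u : Unit) : esize u = 1 := rfl
@[simp] theorem esize_none : esize (none : Option α) = 1 := rfl
@[simp] theorem esize_some (a : α) : esize (some a) = 2 + esize a := rfl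
theorem esize_bool (b : Bool) : esize b ≤ 3 := by cases b <;> decide
@[simp] theorem esize_nat (k : ℕ) : esize k = 2 * k + 1 := by
  induction k with
  | zero => rfl
  | succ k ih => rw [esize, enc_succ, Data.size, ← esize, ih]; simp only [Data.size]; ring

theorem esize_list (l : List α) : esize l = 1 + (l.map fun a => 1 + esize a).sum := by
  induction l with
  | nil => rfl
  | cons a l ih => rw [esize_cons, ih]; simp; ring

theorem length_le_esize (l : List α) : l.length ≤ esize l := by
  induction l with
  | nil => simp
  | cons a l ih => simp; omega

theorem esize_append (l l' : List α) : esize (l ++ l') + 1 = esize l + esize l' := by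
  induction l with
  | nil => simp; ring
  | cons a l ih => simp; omega

theorem esize_le_of_mem {a : α} {l : List α} (h : a ∈ l) : esize a ≤ esize l := by
  induction l with
  | nil => simp at h
  | cons b l ih =>
    rcases List.mem_cons.1 h with rfl | h
    · simp; omega
    · have := ih h; simp; omega

theorem esize_drop_le (l : List α) (i : ℕ) : esize (l.drop i) ≤ esize l := by
  have := esize_append (l.take i) (l.drop i)
  have := esize_pos (l.take i)
  rw [List.take_append_drop] at *
  omega

theorem esize_take_le (l : List α) (i : ℕ) : esize (l.take i) ≤ esize l := by
  have := esize_append (l.take i) (l.drop i)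
  have := esize_pos (l.drop i)
  rw [List.take_append_drop] at *
  omega

theorem esize_list_le (l : List α) (s : ℕ) (h : ∀ a ∈ l, esize a ≤ s) :
    esize l ≤ 1 + l.length * (s + 1) := by
  induction l with
  | nil => simp
  | cons a l ih =>
    have h₁ := h a (by simp)
    have h₂ := ih fun b hb => h b (by simp [hb])
    simp only [esize_cons, List.length_cons]
    linarith

/-! ### Polynomial-time functions -/

/-- The function `f` is computed, on encoded arguments, by a program in time polynomial in `B`. -/
def TimeIn (B : α → ℕ) (f : α → β) : Prop :=
  ∃ (p : Prog) (P : ℕ[X]), ∀ x, p.RunsWithin (enc x) (enc (f x)) (P.eval (B x))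

/-- The function `f` is computed by a program in polynomial time. -/
@[fun_prop]
def PolyTime (f : α → β) : Prop := TimeIn esize f

theorem TimeIn.congr {B : α → ℕ} {f : α → β} {g : α → γ} (hf : TimeIn B f)
    (h : ∀ x, enc (f x) = enc (g x)) : TimeIn B g := by
  obtain ⟨p, P, hp⟩ := hf
  exact ⟨p, P, fun x => h x ▸ hp x⟩

theorem PolyTime.congr {f : α → β} {g : α → γ} (hf : PolyTime f)
    (h : ∀ x, enc (f x) = enc (g x)) : PolyTime g := TimeIn.congr hf h

theorem TimeIn.exists_size_le {B : α → ℕ} {f : α → β} (hf : TimeIn B f) :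
    ∃ P : ℕ[X], ∀ x, esize x ≤ P.eval (B x) ∧ esize (f x) ≤ P.eval (B x) :=
  let ⟨_, P, hp⟩ := hf
  ⟨P, fun x => ⟨(hp x).input_le, (hp x).output_le⟩⟩

theorem PolyTime.exists_size_le {f : α → β} (hf : PolyTime f) :
    ∃ P : ℕ[X], ∀ x, esize (f x) ≤ P.eval (esize x) :=
  let ⟨P, hp⟩ := TimeIn.exists_size_le hf
  ⟨P, fun x => (hp x).2⟩

/-- Functions that do not change the representation. -/
theorem PolyTime.of_enc_eq {f : α → β} (h : ∀ x, enc (f x) = enc x) : PolyTime f :=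
  ⟨.id, X, fun x => by rw [h, eval_X]; exact ⟨_, le_rfl, .id _⟩⟩

@[fun_prop]
theorem PolyTime.id' : PolyTime (fun x : α => x) := .of_enc_eq fun _ => rfl

theorem exists_const_prog (d : Data) :
    ∃ (p : Prog) (P : ℕ[X]), ∀ x, p.RunsWithin x d (P.eval x.size) := by
  induction d with
  | nil => exact ⟨.nil, X, fun x => by rw [eval_X]; exact ⟨_, le_rfl, .nil _⟩⟩
  | cons a b iha ihb =>
    obtain ⟨p, P, hp⟩ := iha
    obtain ⟨q, Q, hq⟩ := ihb
    exact ⟨.pair p q, X + P + Q, fun x => by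
      simpa only [eval_add, eval_X] using (hp x).pair (hq x)⟩

@[fun_prop]
theorem PolyTime.const (b : β) : PolyTime (fun _ : α => b) :=
  let ⟨p, P, h⟩ := exists_const_prog (enc b)
  ⟨p, P, fun x => h (enc x)⟩

theorem TimeIn.comp {B : α → ℕ} {f : α → β} {g : β → γ} (hg : PolyTime g) (hf : TimeIn B f) :
    TimeIn B (fun x => g (f x)) := by
  obtain ⟨p, P, hp⟩ := hf
  obtain ⟨q, Q, hq⟩ := hg
  refine ⟨.seq p q, P + P + Q.comp P, fun x => ((hp x).seq (hq (f x))).mono ?_⟩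
  simp only [eval_add, eval_comp]
  have := eval_mono Q (hp x).output_le
  have := (hp x).input_le
  unfold esize
  omega

@[fun_prop]
theorem PolyTime.comp {f : α → β} {g : β → γ} (hg : PolyTime g) (hf : PolyTime f) :
    PolyTime (fun x => g (f x)) := TimeIn.comp hg hf

theorem TimeIn.prodMk {B : α → ℕ} {f : α → β} {g : α → γ} (hf : TimeIn B f) (hg : TimeIn B g) :
    TimeIn B (fun x => (f x, g x)) := by
  obtain ⟨p, P, hp⟩ := hf
  obtain ⟨q, Q, hq⟩ := hg
  refine ⟨.pair p q, P + P + Q, fun x => ((hp x).pair (hq x)).mono ?_⟩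
  simp only [eval_add]
  have := (hp x).input_le
  omega

@[fun_prop]
theorem PolyTime.prodMk {f : α → β} {g : α → γ} (hf : PolyTime f) (hg : PolyTime g) :
    PolyTime (fun x => (f x, g x)) := TimeIn.prodMk hf hg

@[fun_prop]
theorem PolyTime.fst {f : α → β × γ} (hf : PolyTime f) : PolyTime (fun x => (f x).1) :=
  PolyTime.comp (g := Prod.fst) ⟨.hd, X, fun x => by rw [eval_X]; exact .hd _ _⟩ hf

@[fun_prop]
theorem PolyTime.snd {f : α → β × γ} (hf : PolyTime f) : PolyTime (fun x => (f x).2) :=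
  PolyTime.comp (g := Prod.snd) ⟨.tl, X, fun x => by rw [eval_X]; exact .tl _ _⟩ hf

theorem TimeIn.id_of {B : α → ℕ} {f : α → β} (hf : TimeIn B f) : TimeIn B (fun x : α => x) :=
  let ⟨P, hP⟩ := hf.exists_size_le
  ⟨.id, P, fun x => ⟨_, (hP x).1, .id _⟩⟩

theorem TimeIn.of_polyTime {B : α → ℕ} {f : α → β} (hf : PolyTime f) (hB : ∀ x, esize x ≤ B x) :
    TimeIn B f :=
  let ⟨p, P, hp⟩ := hf
  ⟨p, P, fun x => (hp x).mono (eval_mono P (hB x))⟩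

@[fun_prop]
theorem PolyTime.cond {c : α → Bool} {f g : α → β} (hc : PolyTime c) (hf : PolyTime f)
    (hg : PolyTime g) : PolyTime (fun x => bif c x then f x else g x) := by
  obtain ⟨r, R, hr⟩ := hc
  obtain ⟨p, P, hp⟩ := hf
  obtain ⟨q, Q, hq⟩ := hg
  refine ⟨.cond r p q, X + R + P + Q, fun x => ?_⟩
  obtain ⟨t, ht, hrt⟩ := hr x
  simp only [eval_add, eval_X]
  cases h : c x with
  | true =>
    obtain ⟨u, hu, hpu⟩ := hp x
    rw [h] at hrt
    exact ⟨_, by unfold esize at *; omega, .cond_true hrt (by simp [enc_true]) hpu⟩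
  | false =>
    obtain ⟨u, hu, hqu⟩ := hq x
    rw [h] at hrt
    exact ⟨_, by unfold esize at *; omega, .cond_false hrt hqu⟩

@[fun_prop]
theorem PolyTime.decide_eq [DecidableEq β] {f g : α → β} (hf : PolyTime f) (hg : PolyTime g) :
    PolyTime (fun x => decide (f x = g x)) := by
  refine PolyTime.comp (g := fun p : β × β => decide (p.1 = p.2)) ⟨.eq, X, fun x => ?_⟩
    (hf.prodMk hg)
  rw [eval_X]
  obtain ⟨a, b⟩ := x
  by_cases h : a = b
  · subst h
    simpa [enc_true] using ⟨_, le_rfl, Prog.Runs.eq_true (enc a)⟩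
  · simpa [h, enc_false] using ⟨_, le_rfl, Prog.Runs.eq_false (enc a) (enc b) fun h' => h (inj h')⟩

/-- Case distinction on a list. -/
def listCase (b : β) (f : α → List α → β) : List α → β
  | [] => b
  | a :: l => f a l

@[fun_prop]
theorem PolyTime.caseList {l : γ → List α} {b : γ → β} {f : γ → α → List α → β}
    (hl : PolyTime l) (hb : PolyTime b) (hf : PolyTime fun p : γ × α × List α => f p.1 p.2.1 p.2.2) :
    PolyTime (fun x => listCase (b x) (f x) (l x)) := by
  refine PolyTime.comp (g := fun p : γ × List α => listCase (b p.1) (f p.1) p.2)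
    ?_ (PolyTime.id'.prodMk hl)
  obtain ⟨p, P, hp⟩ := hb
  obtain ⟨q, Q, hq⟩ := hf
  refine ⟨.cond .tl q (.seq .hd p), 4 * X + P + Q, fun x => ?_⟩
  obtain ⟨x, l⟩ := x
  have htl : Prog.tl.Runs (enc (x, l)) (enc l) (enc (x, l)).size := .tl_cons _ _
  have hm := eval_mono P (show esize x ≤ esize (x, l) by simp; omega)
  cases l with
  | nil =>
    obtain ⟨t, ht, hr⟩ := hp x
    refine ⟨_, ?_, .cond_false htl (.seq (.hd_cons _ _) hr)⟩
    simp [esize, enc_prod] at *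
    omega
  | cons a l =>
    obtain ⟨t, ht, hr⟩ := hq (x, a, l)
    refine ⟨_, ?_, .cond_true htl (by simp [enc_cons]) hr⟩
    simp [esize, enc_prod, enc_cons] at *
    omega

/-- Case distinction on an optional value. -/
def optionCase (b : β) (f : α → β) : Option α → β
  | none => b
  | some a => f a

@[fun_prop]
theorem PolyTime.caseOption {o : γ → Option α} {b : γ → β} {f : γ → α → β}
    (ho : PolyTime o) (hb : PolyTime b) (hf : PolyTime fun p : γ × α => f p.1 p.2) :
    PolyTime (fun x => optionCase (b x) (f x) (o x)) := by
  refine PolyTime.comp (g := fun p : γ × Option α => optionCase (b p.1) (f p.1) p.2)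
    ?_ (PolyTime.id'.prodMk ho)
  obtain ⟨p, P, hp⟩ := hb
  obtain ⟨q, Q, hq⟩ := hf
  refine ⟨.cond .tl (.seq (.pair .hd (.seq .tl .tl)) q) (.seq .hd p), 8 * X + P + Q, fun x => ?_⟩
  obtain ⟨x, o⟩ := x
  have htl : Prog.tl.Runs (enc (x, o)) (enc o) (enc (x, o)).size := .tl_cons _ _
  cases o with
  | none =>
    have hm := eval_mono P (show esize x ≤ esize (x, (none : Option α)) by simp; omega)
    obtain ⟨t, ht, hr⟩ := hp x
    refine ⟨_, ?_, .cond_false htl (.seq (.hd_cons _ _) hr)⟩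
    simp [esize, enc_prod] at *
    omega
  | some a =>
    have hm := eval_mono Q (show esize (x, a) ≤ esize (x, some a) by simp)
    obtain ⟨t, ht, hr⟩ := hq (x, a)
    refine ⟨_, ?_, .cond_true htl (by simp [enc_some])
      (.seq (.pair (.hd_cons _ _) (.seq (.tl_cons _ _) (.tl_cons _ _))) hr)⟩
    simp [esize, enc_prod, enc_some, Data.size] at *
    omega

/-- A loop whose body and test are polynomial-time computable, with `N x` passes. The values on the
way need a size bound of their own, as the iterates of a polynomial-time function may grow
exponentially. -/
theorem TimeIn.iterate_while {B : γ → ℕ} {z : γ → α} {c : α → Bool} {f : α → α} (hz : TimeIn B z)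
    (hc : PolyTime c) (hf : PolyTime f) (N : γ → ℕ) (Q : ℕ[X])
    (hs : ∀ x, ∀ i ≤ N x, esize (f^[i] (z x)) ≤ Q.eval (B x)) (hN : ∀ x, N x ≤ Q.eval (B x))
    (h₁ : ∀ x, ∀ i < N x, c (f^[i] (z x)) = true) (h₂ : ∀ x, c (f^[N x] (z x)) = false) :
    TimeIn B (fun x => f^[N x] (z x)) := by
  obtain ⟨r, R, hr⟩ := hz
  obtain ⟨p, P, hp⟩ := hf
  obtain ⟨q, S, hq⟩ := hc
  refine ⟨.seq r (.loop q p), R + R + (Q + 1) * (3 * (S.comp Q + P.comp Q)), fun x => ?_⟩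
  have hS : ∀ i ≤ N x, S.eval (esize (f^[i] (z x))) ≤ S.eval (Q.eval (B x)) :=
    fun i hi => eval_mono S (hs x i hi)
  have hP : ∀ i ≤ N x, P.eval (esize (f^[i] (z x))) ≤ P.eval (Q.eval (B x)) :=
    fun i hi => eval_mono P (hs x i hi)
  refine ((hr x).seq (Prog.RunsWithin.loop (S.eval (Q.eval (B x)) + P.eval (Q.eval (B x))) (N x)
    (fun i => enc (f^[i] (z x))) (fun i hi => ⟨_, ?_, (hq _).mono ?_⟩) ?_ fun i hi => ?_)).mono ?_
  · rw [h₁ x i hi]; simp [enc_true]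
  · exact (hS i hi.le).trans (by omega)
  · have := hq (f^[N x] (z x))
    rw [h₂] at this
    exact this.mono ((hS _ le_rfl).trans (by omega))
  · simp only [Function.iterate_succ_apply']
    exact (hp _).mono ((hP i hi.le).trans (by omega))
  · simp only [eval_add, eval_mul, eval_comp, eval_one, eval_ofNat]
    have := (hr x).input_le
    have : (N x + 1) * (3 * (S.eval (Q.eval (B x)) + P.eval (Q.eval (B x)))) ≤
      (Q.eval (B x) + 1) * (3 * (S.eval (Q.eval (B x)) + P.eval (Q.eval (B x)))) := by
      gcongr; exact hN x
    omega

/-- A fold whose intermediate results have polynomial size. -/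
theorem TimeIn.foldl {B : γ → ℕ} {f : γ → β → α → β} {l : γ → List α} {z : γ → β}
    (hf : PolyTime fun p : γ × β × α => f p.1 p.2.1 p.2.2) (hl : TimeIn B l) (hz : TimeIn B z)
    (Q : ℕ[X]) (hQ : ∀ x i, esize (((l x).take i).foldl (f x) (z x)) ≤ Q.eval (B x)) :
    TimeIn B (fun x => (l x).foldl (f x) (z x)) := by
  obtain ⟨P, hP⟩ := hl.exists_size_le
  -- The loop runs on the triple of the parameter, the accumulator and the rest of the list.
  let step (s : γ × β × List α) : γ × β × List α :=
    listCase s (fun a t => (s.1, f s.1 s.2.1 a, t)) s.2.2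
  have hstep : PolyTime step := by
    refine PolyTime.caseList
      (f := fun (s : γ × β × List α) a t => (s.1, f s.1 s.2.1 a, t)) (by fun_prop) (by fun_prop)
      (PolyTime.prodMk (by fun_prop) (PolyTime.prodMk ?_ (by fun_prop)))
    exact hf.comp (f := fun p : (γ × β × List α) × α × List α => (p.1.1, p.1.2.1, p.2.1))
      (by fun_prop)
  have hit : ∀ x i, i ≤ (l x).length → step^[i] (x, z x, l x) =
      (x, ((l x).take i).foldl (f x) (z x), (l x).drop i) := by
    intro x i hi
    induction i with
    | zero => simp
    | succ i ih =>
      have hd := (List.cons_getElem_drop_succ (h := hi)).symm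
      rw [Function.iterate_succ_apply', ih (by omega), List.take_succ_eq_append_getElem hi]
      simp only [step, hd, listCase, List.foldl_append, List.foldl_cons,
        List.foldl_nil]
  have key := TimeIn.iterate_while (B := B) (z := fun x => (x, z x, l x)) (f := step)
    (c := fun s => listCase false (fun _ _ => true) s.2.2)
    (hl.id_of.prodMk (hz.prodMk hl)) (by fun_prop) hstep (fun x => (l x).length) (2 + 2 * P + Q)
    (fun x i hi => by
      rw [hit x i hi]
      simp only [esize_prod, eval_add, eval_mul, eval_ofNat]
      have := hQ x i
      have := esize_drop_le (l x) i
      have := hP x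
      omega)
    (fun x => by
      simp only [eval_add, eval_mul, eval_ofNat]
      have := length_le_esize (l x)
      have := hP x
      omega)
    (fun x i hi => by
      rw [hit x i hi.le, ← List.cons_getElem_drop_succ (h := hi)]
      rfl)
    (fun x => by rw [hit x _ le_rfl]; simp [listCase])
  refine (key.comp (g := fun s => s.2.1) (by fun_prop)).congr fun x => ?_
  rw [hit x _ le_rfl]
  simp

theorem PolyTime.foldl {f : γ → β → α → β} {l : γ → List α} {z : γ → β}
    (hf : PolyTime fun p : γ × β × α => f p.1 p.2.1 p.2.2) (hl : PolyTime l) (hz : PolyTime z)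
    (Q : ℕ[X]) (hQ : ∀ x i, esize (((l x).take i).foldl (f x) (z x)) ≤ Q.eval (esize x)) :
    PolyTime (fun x => (l x).foldl (f x) (z x)) := TimeIn.foldl hf hl hz Q hQ

/-! ### Polynomial-time operations on lists -/

@[fun_prop]
theorem PolyTime.listCons {f : γ → α} {l : γ → List α} (hf : PolyTime f) (hl : PolyTime l) :
    PolyTime (fun x => f x :: l x) :=
  (hf.prodMk hl).congr fun _ => rfl

@[fun_prop]
theorem PolyTime.optionSome {f : γ → α} (hf : PolyTime f) : PolyTime (fun x => some (f x)) :=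
  (PolyTime.prodMk (PolyTime.const ()) hf).congr fun _ => rfl

@[fun_prop]
theorem PolyTime.and {b c : γ → Bool} (hb : PolyTime b) (hc : PolyTime c) :
    PolyTime (fun x => b x && c x) :=
  (hb.cond hc (PolyTime.const false)).congr fun x => by cases b x <;> rfl

@[fun_prop]
theorem PolyTime.or {b c : γ → Bool} (hb : PolyTime b) (hc : PolyTime c) :
    PolyTime (fun x => b x || c x) :=
  (hb.cond (PolyTime.const true) hc).congr fun x => by cases b x <;> rfl

@[fun_prop]
theorem PolyTime.not {b : γ → Bool} (hb : PolyTime b) : PolyTime (fun x => !b x) :=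
  (hb.cond (PolyTime.const false) (PolyTime.const true)).congr fun x => by cases b x <;> rfl

@[fun_prop]
theorem PolyTime.beq [BEq α] [LawfulBEq α] {f g : γ → α} (hf : PolyTime f) (hg : PolyTime g) :
    PolyTime (fun x => f x == g x) := by
  classical
  exact (hf.decide_eq hg).congr fun x => by
    rw [show decide (f x = g x) = (f x == g x) from Bool.eq_iff_iff.2 (by simp)]

/-- The number `n` as a list of length `n` without content. Both have the same encoding. -/
def unitList (n : ℕ) : List Unit := List.replicate n ()

@[simp] theorem length_unitList (n : ℕ) : (unitList n).length = n := by simp [unitList]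

theorem enc_list_unit (l : List Unit) : enc l = enc l.length := by
  induction l with
  | nil => rfl
  | cons a l ih => rw [enc_cons, ih]; rfl

@[fun_prop]
theorem PolyTime.toUnitList {n : γ → ℕ} (hn : PolyTime n) : PolyTime (fun x => unitList (n x)) :=
  hn.congr fun x => by rw [enc_list_unit, length_unitList]

theorem esize_reverse (l : List α) : esize l.reverse = esize l := by
  simp [esize_list, List.sum_reverse]

theorem foldl_cons_eq {α : Type} (l z : List α) : l.foldl (fun b a => a :: b) z = l.reverse ++ z := by
  induction l generalizing z with
  | nil => rfl
  | cons a l ih => simp [ih]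

@[fun_prop]
theorem PolyTime.reverse {l : γ → List α} (hl : PolyTime l) : PolyTime (fun x => (l x).reverse) := by
  obtain ⟨P, hP⟩ := hl.exists_size_le
  refine (PolyTime.foldl (f := fun _ (b : List α) a => a :: b) (z := fun _ => []) (by fun_prop) hl
    (by fun_prop) P fun x i => ?_).congr fun x => by rw [foldl_cons_eq, List.append_nil]
  rw [foldl_cons_eq, List.append_nil, esize_reverse]
  exact (esize_take_le _ _).trans (hP x)

@[fun_prop]
theorem PolyTime.append {l l' : γ → List α} (hl : PolyTime l) (hl' : PolyTime l') :
    PolyTime (fun x => l x ++ l' x) := by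
  obtain ⟨P, hP⟩ := hl.exists_size_le
  obtain ⟨P', hP'⟩ := hl'.exists_size_le
  refine (PolyTime.foldl (f := fun _ (b : List α) a => a :: b) (by fun_prop) hl.reverse hl' (P + P')
    fun x i => ?_).congr fun x => by rw [foldl_cons_eq, List.reverse_reverse]
  rw [foldl_cons_eq, eval_add]
  have h₁ := esize_append ((l x).reverse.take i).reverse (l' x)
  have h₂ := esize_take_le (l x).reverse i
  rw [esize_reverse] at h₁ h₂
  have := hP x
  have := hP' x
  omega

@[fun_prop]
theorem PolyTime.listMap {l : γ → List α} {f : γ → α → β} (hl : PolyTime l)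
    (hf : PolyTime fun p : γ × α => f p.1 p.2) : PolyTime (fun x => (l x).map (f x)) := by
  obtain ⟨P, hP⟩ := hl.exists_size_le
  obtain ⟨Q, hQ⟩ := hf.exists_size_le
  have key (x : γ) (l : List α) (z : List β) :
      l.foldl (fun b a => f x a :: b) z = (l.map (f x)).reverse ++ z := by
    induction l generalizing z with
    | nil => rfl
    | cons a l ih => simp [ih]
  refine ((PolyTime.foldl (f := fun x (b : List β) a => f x a :: b) (z := fun _ => []) ?_ hl
    (by fun_prop) (1 + P * (Q.comp (1 + X + P) + 1)) fun x i => ?_).reverse).congr fun x => by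
      rw [key]; simp
  · exact PolyTime.listCons
      (hf.comp (f := fun p : γ × List β × α => (p.1, p.2.2)) (by fun_prop)) (by fun_prop)
  · rw [key, List.append_nil, esize_reverse]
    refine (esize_list_le _ (Q.eval (1 + esize x + P.eval (esize x))) ?_).trans ?_
    · intro b hb
      obtain ⟨a, ha, rfl⟩ := List.mem_map.1 hb
      refine (hQ (x, a)).trans (eval_mono Q ?_)
      have := esize_le_of_mem (List.mem_of_mem_take ha)
      have := hP x
      simp only [esize_prod]
      omega
    · simp only [eval_add, eval_mul, eval_comp, eval_X, eval_one]
      gcongr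
      have := length_le_esize (l x)
      have := hP x
      simp
      omega

@[fun_prop]
theorem PolyTime.length {l : γ → List α} (hl : PolyTime l) : PolyTime (fun x => (l x).length) :=
  (PolyTime.listMap (f := fun _ _ => ()) hl (by fun_prop)).congr fun x => by
    rw [enc_list_unit, List.length_map]

theorem esize_flatten_le (l : List (List α)) : esize l.flatten ≤ esize l := by
  induction l with
  | nil => rfl
  | cons a l ih =>
    have := esize_append a l.flatten
    simp only [List.flatten_cons, esize_cons]
    omega

@[fun_prop]
theorem PolyTime.flatten {l : γ → List (List α)} (hl : PolyTime l) :
    PolyTime (fun x => (l x).flatten) := by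
  obtain ⟨P, hP⟩ := hl.exists_size_le
  have key (l : List (List α)) (z : List α) : l.foldl (fun b a => b ++ a) z = z ++ l.flatten := by
    induction l generalizing z with
    | nil => simp
    | cons a l ih => simp [ih]
  refine (PolyTime.foldl (f := fun _ (b : List α) a => b ++ a) (z := fun _ => []) (by fun_prop) hl
    (by fun_prop) P fun x i => ?_).congr fun x => by rw [key, List.nil_append]
  rw [key, List.nil_append]
  exact (esize_flatten_le _).trans ((esize_take_le _ _).trans (hP x))

@[fun_prop]
theorem PolyTime.flatMap {l : γ → List α} {f : γ → α → List β} (hl : PolyTime l)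
    (hf : PolyTime fun p : γ × α => f p.1 p.2) : PolyTime (fun x => (l x).flatMap (f x)) :=
  (hl.listMap hf).flatten.congr fun x => by rw [List.flatMap_def]

@[fun_prop]
theorem PolyTime.filter {l : γ → List α} {c : γ → α → Bool} (hl : PolyTime l)
    (hc : PolyTime fun p : γ × α => c p.1 p.2) : PolyTime (fun x => (l x).filter (c x)) :=
  (PolyTime.flatMap (f := fun x a => bif c x a then [a] else []) hl (by fun_prop)).congr fun x => by
    congr 1
    induction l x with
    | nil => rfl
    | cons a l ih =>
      rw [List.flatMap_cons, ih]
      cases h : c x a <;> simp [h]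

@[fun_prop]
theorem PolyTime.head? {l : γ → List α} (hl : PolyTime l) : PolyTime (fun x => (l x).head?) :=
  (PolyTime.caseList (f := fun _ a _ => some a) hl (PolyTime.const none) (by fun_prop)).congr
    fun x => by cases l x <;> rfl

@[fun_prop]
theorem PolyTime.tail {l : γ → List α} (hl : PolyTime l) : PolyTime (fun x => (l x).tail) :=
  (PolyTime.caseList (f := fun _ _ t => t) hl (PolyTime.const []) (by fun_prop)).congr
    fun x => by cases l x <;> rfl

@[fun_prop]
theorem PolyTime.getD {o : γ → Option α} {b : γ → α} (ho : PolyTime o) (hb : PolyTime b) :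
    PolyTime (fun x => (o x).getD (b x)) :=
  (PolyTime.caseOption (f := fun _ a => a) ho hb (by fun_prop)).congr fun x => by cases o x <;> rfl

@[fun_prop]
theorem PolyTime.isSome {o : γ → Option α} (ho : PolyTime o) : PolyTime (fun x => (o x).isSome) :=
  (PolyTime.caseOption (f := fun _ _ => true) ho (PolyTime.const false) (by fun_prop)).congr
    fun x => by cases o x <;> rfl

@[fun_prop]
theorem PolyTime.find? {l : γ → List α} {c : γ → α → Bool} (hl : PolyTime l)
    (hc : PolyTime fun p : γ × α => c p.1 p.2) : PolyTime (fun x => (l x).find? (c x)) :=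
  (hl.filter hc).head?.congr fun x => by rw [List.head?_filter]

@[fun_prop]
theorem PolyTime.any {l : γ → List α} {c : γ → α → Bool} (hl : PolyTime l)
    (hc : PolyTime fun p : γ × α => c p.1 p.2) : PolyTime (fun x => (l x).any (c x)) :=
  (hl.find? hc).isSome.congr fun x => by
    congr 1
    rw [Bool.eq_iff_iff, List.find?_isSome, List.any_eq_true]

@[fun_prop]
theorem PolyTime.all {l : γ → List α} {c : γ → α → Bool} (hl : PolyTime l)
    (hc : PolyTime fun p : γ × α => c p.1 p.2) : PolyTime (fun x => (l x).all (c x)) :=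
  (PolyTime.any hl hc.not).not.congr fun x => by
    congr 1
    rw [List.all_eq_not_any_not]

@[fun_prop]
theorem PolyTime.drop {l : γ → List α} {n : γ → ℕ} (hl : PolyTime l) (hn : PolyTime n) :
    PolyTime (fun x => (l x).drop (n x)) := by
  obtain ⟨P, hP⟩ := hl.exists_size_le
  have key (u : List Unit) (z : List α) : u.foldl (fun b _ => b.tail) z = z.drop u.length := by
    induction u generalizing z with
    | nil => rfl
    | cons a u ih => simp [ih]
  refine (PolyTime.foldl (f := fun _ (b : List α) (_ : Unit) => b.tail) (by fun_prop) hn.toUnitList hl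
    P fun x i => ?_).congr fun x => by rw [key, length_unitList]
  rw [key]
  exact (esize_drop_le _ _).trans (hP x)

@[fun_prop]
theorem PolyTime.getElem? {l : γ → List α} {n : γ → ℕ} (hl : PolyTime l) (hn : PolyTime n) :
    PolyTime (fun x => (l x)[n x]?) :=
  (hl.drop hn).head?.congr fun x => by rw [List.head?_drop]

@[fun_prop]
theorem PolyTime.zip {l : γ → List α} {l' : γ → List β} (hl : PolyTime l) (hl' : PolyTime l') :
    PolyTime (fun x => (l x).zip (l' x)) := by
  obtain ⟨P, hP⟩ := hl.exists_size_le
  obtain ⟨P', hP'⟩ := hl'.exists_size_le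
  have key (l : List α) (l' : List β) (z : List (α × β)) :
      l.foldl (fun (b : List β × List (α × β)) a =>
        listCase ([], b.2) (fun c t => (t, (a, c) :: b.2)) b.1) (l', z) =
      (l'.drop l.length, (l.zip l').reverse ++ z) := by
    induction l generalizing l' z with
    | nil => simp
    | cons a l ih =>
      cases l' with
      | nil => exact (ih [] z).trans (by simp)
      | cons c l' => exact (ih l' ((a, c) :: z)).trans (by simp)
  have hz (l : List α) (l' : List β) : esize (l.zip l') ≤ esize l + 2 * esize l' := by
    induction l generalizing l' with
    | nil => simp
    | cons a l ih =>
      cases l' with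
      | nil => simp
      | cons c l' => have := ih l'; simp; omega
  refine ((PolyTime.foldl (f := fun _ (b : List β × List (α × β)) a =>
    listCase ([], b.2) (fun c t => (t, (a, c) :: b.2)) b.1) (z := fun x => (l' x, []))
    (PolyTime.caseList (f := fun (p : γ × (List β × List (α × β)) × α) c t => (t, (p.2.2, c) :: p.2.1.2))
      (by fun_prop) (by fun_prop) (by fun_prop)) hl
    (by fun_prop) (1 + P + 3 * P') fun x i => ?_).snd.reverse).congr fun x => by rw [key]; simp
  rw [key]
  simp only [esize_prod, List.append_nil, esize_reverse, eval_add, eval_mul, eval_ofNat, eval_one]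
  have := hz ((l x).take i) (l' x)
  have := esize_take_le (l x) i
  have := esize_drop_le (l' x) ((l x).take i).length
  have := hP x
  have := hP' x
  omega

@[fun_prop]
theorem PolyTime.lookup [BEq α] [LawfulBEq α] {l : γ → List (α × β)} {k : γ → α} (hk : PolyTime k)
    (hl : PolyTime l) : PolyTime (fun x => (l x).lookup (k x)) :=
  (PolyTime.caseOption (f := fun _ (a : α × β) => some a.2)
    (PolyTime.find? (c := fun x a => k x == a.1) hl (by fun_prop)) (PolyTime.const none)
    (by fun_prop)).congr fun x => by
      congr 1
      induction l x with
      | nil => rfl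
      | cons a l ih =>
        rw [List.find?_cons, List.lookup_cons, ← ih]
        cases k x == a.1 <;> rfl

@[fun_prop]
theorem PolyTime.range {n : γ → ℕ} (hn : PolyTime n) : PolyTime (fun x => List.range (n x)) := by
  obtain ⟨P, hP⟩ := hn.exists_size_le
  have key (u : List Unit) : u.foldl (fun (b : List ℕ) _ => b.length :: b) [] =
      (List.range u.length).reverse := by
    induction u using List.reverseRecOn with
    | nil => rfl
    | append_singleton u a ih => simp [ih, List.range_succ]
  refine ((PolyTime.foldl (f := fun _ (b : List ℕ) (_ : Unit) => b.length :: b) (z := fun _ => [])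
    (by fun_prop) hn.toUnitList (by fun_prop) (1 + P * (2 * P + 2)) fun x i => ?_).reverse).congr
    fun x => by rw [key, List.reverse_reverse, length_unitList]
  rw [key, esize_reverse]
  have h := hP x
  rw [esize_nat] at h
  refine (esize_list_le _ (2 * P.eval (esize x) + 1) ?_).trans ?_
  · intro a ha
    simp at ha
    simp
    omega
  · simp only [eval_add, eval_mul, eval_ofNat, eval_one]
    refine Nat.add_le_add_left (Nat.mul_le_mul ?_ le_rfl) 1
    simp
    omega

@[fun_prop]
theorem PolyTime.add {m n : γ → ℕ} (hm : PolyTime m) (hn : PolyTime n) :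
    PolyTime (fun x => m x + n x) :=
  (hm.toUnitList.append hn.toUnitList).congr fun x => by simp [enc_list_unit]

@[fun_prop]
theorem PolyTime.mul {m n : γ → ℕ} (hm : PolyTime m) (hn : PolyTime n) :
    PolyTime (fun x => m x * n x) :=
  (PolyTime.flatMap (f := fun x _ => unitList (n x)) hm.toUnitList
    (by fun_prop)).congr fun x => by simp [enc_list_unit]

@[fun_prop]
theorem PolyTime.idxOf [BEq α] [LawfulBEq α] {l : γ → List α} {a : γ → α} (ha : PolyTime a)
    (hl : PolyTime l) : PolyTime (fun x => (l x).idxOf (a x)) := by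
  have key (a : α) (l : List α) (n : ℕ) :
      ((l.zip (List.range' n l.length)).lookup a).getD (n + l.length) = n + l.idxOf a := by
    induction l generalizing n with
    | nil => rfl
    | cons b l ih =>
      rw [List.length_cons, List.range'_succ, List.zip_cons_cons, List.lookup_cons]
      by_cases h : a = b
      · subst h; simp
      · rw [beq_eq_false_iff_ne.2 h, List.idxOf_cons_ne _ (Ne.symm h)]
        have := ih (n + 1)
        simp only [Nat.succ_eq_add_one]
        rw [show n + (l.length + 1) = n + 1 + l.length by ring, this]
        ring
  refine (PolyTime.getD (o := fun x => ((l x).zip (List.range (l x).length)).lookup (a x))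
    (b := fun x => (l x).length) (by fun_prop) (by fun_prop)).congr fun x => ?_
  have := key (a x) (l x) 0
  rw [← List.range_eq_range', zero_add, zero_add] at this
  rw [this]

/-! ### Valuations as bit lists -/

/-- The bit at position `i`. -/
def bit (l : List Bool) (i : ℕ) : Bool := (l[i]?).getD false

@[fun_prop]
theorem PolyTime.bit {l : γ → List Bool} {i : γ → ℕ} (hl : PolyTime l) (hi : PolyTime i) :
    PolyTime (fun x => bit (l x) (i x)) := (hl.getElem? hi).getD (PolyTime.const false)

@[simp]
theorem bit_ofFn {k : ℕ} (f : Fin k → Bool) (i : Fin k) : bit (List.ofFn f) i = f i := by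
  simp [bit]

theorem enc_ofFn_bool {k : ℕ} (v : Fin k → Bool) : enc (List.ofFn v) = encVal v := by
  change encList _ = encList _
  rw [List.map_ofFn]
  rfl

theorem enc_ofFn {k : ℕ} (f : Fin k → α) : enc (List.ofFn f) = encList (List.ofFn fun i => enc (f i)) := by
  change encList _ = encList _
  rw [List.map_ofFn]
  rfl

theorem enc_map {α : Type} (f : α → β) (l : List α) :
    enc (l.map f) = encList (l.map fun a => enc (f a)) := by
  change encList _ = encList _
  rw [List.map_map]
  rfl

open Classical in
/-- The characteristic vector of a set, as a list. -/
noncomputable def setBits {k : ℕ} (A : Set (Fin k)) : List Bool := List.ofFn fun i => decide (i ∈ A)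

theorem bit_setBits {k : ℕ} {A : Set (Fin k)} {i : Fin k} : bit (setBits A) i = true ↔ i ∈ A := by
  classical
  rw [setBits, bit_ofFn, decide_eq_true_iff]

theorem ofFn_eq_setBits {k : ℕ} {A : Set (Fin k)} {f : Fin k → Bool}
    (h : ∀ i, f i = true ↔ i ∈ A) : List.ofFn f = setBits A := by
  classical
  rw [setBits]
  congr 1
  funext i
  exact Bool.eq_iff_iff.2 ((h i).trans (decide_eq_true_iff).symm)

theorem enc_setBits {k : ℕ} (A : Set (Fin k)) : enc (setBits A) = encSet A := enc_ofFn_bool _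

/-- The two valuations of a letter, as lists. -/
def letterBits {m n : ℕ} (a : Letter m n) : List Bool × List Bool :=
  (List.ofFn a.1, List.ofFn a.2)

theorem letterBits_injective {m n : ℕ} : Function.Injective (letterBits (m := m) (n := n)) := by
  intro a b h
  simp only [letterBits, Prod.mk.injEq] at h
  exact Prod.ext (List.ofFn_injective h.1) (List.ofFn_injective h.2)

theorem enc_letterBits {m n : ℕ} (a : Letter m n) : enc (letterBits a) = encLetter a := by
  rw [letterBits, enc_prod, enc_ofFn_bool, enc_ofFn_bool]
  rfl

theorem mem_allVals {k : ℕ} (v : Fin k → Bool) : v ∈ allVals k := by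
  induction k with
  | zero => simp [allVals]; exact Subsingleton.elim _ _
  | succ k ih =>
    simp only [allVals, List.mem_flatMap, List.mem_map]
    exact ⟨v 0, by cases v 0 <;> simp, Fin.tail v, ih _, Fin.cons_self_tail v⟩

theorem length_allVals (k : ℕ) : (allVals k).length = 2 ^ k := by
  induction k with
  | zero => rfl
  | succ k ih => simp [allVals, ih, pow_succ]; ring

theorem nodup_allVals (k : ℕ) : (allVals k).Nodup := by
  induction k with
  | zero => simp [allVals]
  | succ k ih =>
    have (b : Bool) : ((allVals k).map fun v => (Fin.cons b v : Fin (k + 1) → Bool)).Nodup :=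
      ih.map fun v w h => (Fin.cons_inj.1 h).2
    simp only [allVals, List.flatMap_cons, List.flatMap_nil, List.append_nil]
    refine (this false).append (this true) fun v hv hv' => ?_
    simp only [List.mem_map] at hv hv'
    obtain ⟨_, _, rfl⟩ := hv
    obtain ⟨_, _, h⟩ := hv'
    simpa using (Fin.cons_inj.1 h).1

theorem mem_allLetters {m n : ℕ} (a : Letter m n) : a ∈ allLetters m n :=
  List.pair_mem_product.2 ⟨mem_allVals _, mem_allVals _⟩

/-- The list of all bit lists of length `k`, in lexicographic order. -/
def allBits (k : ℕ) : List (List Bool) :=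
  (unitList k).foldl (fun l _ => l.map (false :: ·) ++ l.map (true :: ·)) [[]]

theorem allBits_succ (k : ℕ) :
    allBits (k + 1) = (allBits k).map (false :: ·) ++ (allBits k).map (true :: ·) := by
  rw [allBits, unitList, List.replicate_succ', List.foldl_append]
  rfl

theorem allBits_eq (k : ℕ) : allBits k = (allVals k).map List.ofFn := by
  induction k with
  | zero => simp [allBits, unitList, allVals]
  | succ k ih => simp [allBits_succ, ih, allVals, List.ofFn_succ, Function.comp_def]

theorem mem_allBits_iff {k : ℕ} {l : List Bool} : l ∈ allBits k ↔ l.length = k := by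
  rw [allBits_eq, List.mem_map]
  constructor
  · rintro ⟨v, -, rfl⟩; simp
  · rintro rfl; exact ⟨l.get, mem_allVals _, List.ofFn_get l⟩

/-- The lists built on the way are the lists `allBits i` for `i ≤ k`, of size polynomial in `2 ^ k`. -/
theorem timeIn_allBits : TimeIn (fun k => 2 ^ k) allBits := by
  have hid : TimeIn (fun k : ℕ => 2 ^ k) fun k => k := by
    refine ⟨.id, 2 * X, fun k => ⟨_, ?_, .id _⟩⟩
    have : k < 2 ^ k := Nat.lt_two_pow_self
    change esize k ≤ _
    simp
    omega
  refine TimeIn.foldl (f := fun (_ : ℕ) (l : List (List Bool)) (_ : Unit) =>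
      l.map (false :: ·) ++ l.map (true :: ·)) (z := fun _ => [[]]) (by fun_prop)
    (hid.comp (g := unitList) (PolyTime.toUnitList PolyTime.id'))
    (hid.comp (g := fun _ => [[]]) (by fun_prop))
    (1 + X * (4 * X + 2)) fun k i => ?_
  have : List.foldl (fun (l : List (List Bool)) (_ : Unit) =>
      l.map (false :: ·) ++ l.map (true :: ·)) [[]] ((unitList k).take i) = allBits (min i k) := by
    rw [allBits, unitList, List.take_replicate]; rfl
  rw [this]
  have hm : min i k ≤ k := min_le_right _ _
  refine (esize_list_le _ (4 * 2 ^ k + 1) fun l hl => ?_).trans ?_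
  · refine (esize_list_le _ 3 fun b _ => esize_bool b).trans ?_
    rw [mem_allBits_iff] at hl
    have : k < 2 ^ k := Nat.lt_two_pow_self
    omega
  · rw [allBits_eq, List.length_map, length_allVals]
    simp only [eval_add, eval_mul, eval_ofNat, eval_one, eval_X]
    refine Nat.add_le_add_left (Nat.mul_le_mul ?_ (by omega)) 1
    exact Nat.pow_le_pow_right (by norm_num) hm

/-! ### Automata tables -/

/-- The contents of an encoded automaton: the letters as pairs of bit lists, the number of states,
the start, the transition table and the final states. States or sets of states are of type `τ`. -/
abbrev Table (τ : Type) : Type :=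
  List (List Bool × List Bool) × ℕ × τ × List (List τ) × List Bool × Unit

/-- The table of an automaton with states `0, …, k - 1`. -/
def tableOf {m n k : ℕ} {τ : Type} (start : τ) (step : Fin k → Letter m n → τ)
    (accept : Fin k → Bool) : Table τ :=
  ((allLetters m n).map letterBits, k, start,
    List.ofFn fun s => (allLetters m n).map (step s), List.ofFn accept, ())

/-- The table with the states listed in `S`. -/
def mkTable {σ τ : Type} (L : List (List Bool × List Bool)) (S : List σ) (start : τ)
    (step : σ → List Bool × List Bool → τ) (accept : σ → Bool) : Table τ :=
  (L, S.length, start, S.map fun s => L.map (step s), S.map accept, ())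

@[fun_prop]
theorem PolyTime.mkTable {L : γ → List (List Bool × List Bool)} {S : γ → List α} {start : γ → β}
    {step : γ → α → List Bool × List Bool → β} {accept : γ → α → Bool}
    (hL : PolyTime L) (hS : PolyTime S) (hstart : PolyTime start)
    (hstep : PolyTime fun p : (γ × α) × List Bool × List Bool => step p.1.1 p.1.2 p.2)
    (haccept : PolyTime fun p : γ × α => accept p.1 p.2) :
    PolyTime (fun x => mkTable (L x) (S x) (start x) (step x) (accept x)) := by
  exact hL.prodMk (hS.length.prodMk (hstart.prodMk ((hS.listMap
    (f := fun x s => (L x).map (step x s)) (PolyTime.listMap (f := fun (p : γ × α) => step p.1 p.2)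
      (by fun_prop) hstep)).prodMk ((hS.listMap haccept).prodMk (.const ())))))

theorem mkTable_ofFn {m n k : ℕ} {σ τ : Type} (g : Fin k → σ) (start : τ)
    (step : σ → List Bool × List Bool → τ) (accept : σ → Bool) :
    mkTable ((allLetters m n).map letterBits) (List.ofFn g) start step accept =
      tableOf start (fun s (a : Letter m n) => step (g s) (letterBits a)) fun s => accept (g s) := by
  simp [mkTable, tableOf, List.map_ofFn, Function.comp_def]

theorem range_eq_ofFn (k : ℕ) : List.range k = List.ofFn fun i : Fin k => (i : ℕ) := by
  apply List.ext_getElem <;> simp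

/-- The entry of the transition table for the state `s` and the letter `a`, found by searching `a` in
the listed alphabet; `d` if there is none. -/
def entry {τ : Type} (d : τ) (t : Table τ) (s : ℕ) (a : List Bool × List Bool) : τ :=
  ((t.1.zip ((t.2.2.2.1[s]?).getD [])).lookup a).getD d

@[fun_prop]
theorem PolyTime.entry {d : γ → α} {t : γ → Table α} {s : γ → ℕ} {a : γ → List Bool × List Bool}
    (hd : PolyTime d) (ht : PolyTime t) (hs : PolyTime s) (ha : PolyTime a) :
    PolyTime (fun x => entry (d x) (t x) (s x) (a x)) := by
  unfold UnreliableSynthesis.entry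
  fun_prop

theorem lookup_zip_map {α β τ : Type} [BEq β] [LawfulBEq β] {r : α → β} (hr : Function.Injective r)
    (f : α → τ) {a : α} {l : List α} (ha : a ∈ l) :
    ((l.map r).zip (l.map f)).lookup (r a) = some (f a) := by
  induction l with
  | nil => simp at ha
  | cons b l ih =>
    rw [List.map_cons, List.map_cons, List.zip_cons_cons, List.lookup_cons]
    by_cases h : a = b
    · subst h; simp
    · rw [beq_eq_false_iff_ne.2 (hr.ne h)]
      exact ih ((List.mem_cons.1 ha).resolve_left h)

@[simp]
theorem entry_tableOf {m n k : ℕ} {τ : Type} (d start : τ) (step : Fin k → Letter m n → τ)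
    (accept : Fin k → Bool) (s : Fin k) (a : Letter m n) :
    entry d (tableOf start step accept) s (letterBits a) = step s a := by
  simp [entry, tableOf, lookup_zip_map letterBits_injective _ (mem_allLetters a)]

open Classical in
/-- The table of a nondeterministic automaton. -/
noncomputable def nfaTable {m n k : ℕ} (N : NFA (Letter m n) (Fin k)) : Table (List Bool) :=
  tableOf (setBits N.start) (fun s a => setBits (N.step s a)) fun s => decide (s ∈ N.accept)

open Classical in
/-- The table of a deterministic automaton. -/
noncomputable def dfaTable {m n k : ℕ} (M : DFA (Letter m n) (Fin k)) : Table ℕ :=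
  tableOf (M.start : ℕ) (fun s a => (M.step s a : ℕ)) fun s => decide (s ∈ M.accept)

theorem enc_nfaTable {m n k : ℕ} (N : NFA (Letter m n) (Fin k)) : enc (nfaTable N) = encNFA N := by
  simp only [nfaTable, tableOf, enc_prod, enc_map, enc_ofFn, enc_letterBits,
    enc_setBits]
  rfl

theorem enc_dfaTable {m n k : ℕ} (M : DFA (Letter m n) (Fin k)) : enc (dfaTable M) = encDFA M := by
  simp only [dfaTable, tableOf, enc_prod, enc_map, enc_ofFn, enc_letterBits]
  rfl

theorem esize_nfaTable {m n k : ℕ} (N : NFA (Letter m n) (Fin k)) :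
    esize (nfaTable N) = (encNFA N).size := by rw [esize, enc_nfaTable]

theorem esize_dfaTable {m n k : ℕ} (M : DFA (Letter m n) (Fin k)) :
    esize (dfaTable M) = (encDFA M).size := by rw [esize, enc_dfaTable]

/-! ### Existential abstraction -/

/-- The valuations `x` and `y` agree outside `u`. -/
def agreeOff (u x y : List Bool) : Bool :=
  (u.zip (x.zip y)).all fun p => p.1 || p.2.1 == p.2.2

/-- Existential abstraction on tables. -/
def abstrTable (p : List Bool × Table (List Bool)) : Table (List Bool) :=
  let (u, t) := p
  mkTable t.1 (List.range t.2.1) t.2.2.1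
    (fun s a => (List.range t.2.1).map fun s' =>
      t.1.any fun b => (agreeOff u a.1 b.1 && decide (a.2 = b.2)) && bit (entry [] t s b) s')
    (bit t.2.2.2.2.1)

theorem polyTime_abstrTable : PolyTime abstrTable := by
  unfold abstrTable agreeOff
  fun_prop

theorem agreeOff_ofFn {m : ℕ} (u x y : Fin m → Bool) :
    agreeOff (List.ofFn u) (List.ofFn x) (List.ofFn y) = true ↔ ∀ v, u v = false → x v = y v := by
  simp only [agreeOff, List.all_eq_true, List.mem_iff_getElem]
  constructor
  · intro h v hv
    have := h (u v, x v, y v) ⟨v, by simp, by simp⟩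
    simpa [hv] using this
  · rintro h _ ⟨i, hi, rfl⟩
    have := h ⟨i, by simpa using hi⟩
    simp only [List.getElem_zip, List.getElem_ofFn, Bool.or_eq_true, beq_iff_eq]
    rwa [or_iff_not_imp_left, Bool.not_eq_true]

theorem abstrTable_nfaTable {m n k : ℕ} (U : Finset (Fin m)) (N : NFA (Letter m n) (Fin k)) :
    abstrTable (setBits (U : Set (Fin m)), nfaTable N) = nfaTable (existsAbs U N) := by
  have h₁ : (nfaTable N).1 = (allLetters m n).map letterBits := rfl
  have h₂ : (nfaTable N).2.1 = k := rfl
  simp only [abstrTable, h₁, h₂]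
  rw [range_eq_ofFn, mkTable_ofFn]
  unfold nfaTable
  congr 1
  · funext s a
    rw [List.map_ofFn]
    refine ofFn_eq_setBits fun s' => ?_
    simp only [List.any_map, List.any_eq_true, Function.comp_apply, entry_tableOf,
      Bool.and_eq_true, decide_eq_true_eq]
    constructor
    · rintro ⟨b, -, ⟨h₁, h₂⟩, h₃⟩
      refine ⟨b.1, fun v hv => (agreeOff_ofFn _ _ _).1 h₁ v (by simpa using hv), ?_⟩
      rw [bit_setBits] at h₃
      rwa [List.ofFn_injective h₂]
    · rintro ⟨X', h₁, h₂⟩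
      refine ⟨(X', a.2), mem_allLetters _, ⟨(agreeOff_ofFn _ _ _).2 fun v hv => h₁ v ?_, rfl⟩, ?_⟩
      · simpa using hv
      · rwa [bit_setBits]
  · funext s
    exact bit_ofFn _ _

/-! ### Complementation -/

/-- Complementation on tables. -/
def complTable (t : Table ℕ) : Table ℕ :=
  (t.1, t.2.1, t.2.2.1, t.2.2.2.1, t.2.2.2.2.1.map fun b => !b, ())

theorem polyTime_complTable : PolyTime complTable := by
  unfold complTable
  fun_prop

theorem complTable_dfaTable {m n k : ℕ} (M : DFA (Letter m n) (Fin k)) :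
    complTable (dfaTable M) = dfaTable Mᶜ := by
  simp only [complTable, dfaTable, tableOf, List.map_ofFn, DFA.compl_def, Function.comp_def]
  congr 6
  funext s
  by_cases h : s ∈ M.accept <;> simp [h]

/-! ### Determinization -/

/-- The subset construction on tables; `vs` is the list of all subsets. -/
def detTable (p : Table (List Bool) × List (List Bool)) : Table ℕ :=
  let (t, vs) := p
  mkTable t.1 vs (vs.idxOf t.2.2.1)
    (fun v a => vs.idxOf ((List.range t.2.1).map fun s' =>
      (List.range t.2.1).any fun s => bit v s && bit (entry [] t s a) s'))
    fun v => (List.range t.2.1).any fun s => bit v s && bit t.2.2.2.2.1 s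

theorem polyTime_detTable : PolyTime detTable := by
  unfold detTable
  fun_prop

theorem idxOf_allBits {k : ℕ} (e : Fin (allVals k).length ≃ (Fin k → Bool))
    (he : ∀ i, e i = (allVals k)[i]) (v : Fin k → Bool) :
    (allBits k).idxOf (List.ofFn v) = (e.symm v : ℕ) := by
  obtain ⟨i, rfl⟩ := e.surjective v
  rw [Equiv.symm_apply_apply]
  have hnd : (allBits k).Nodup := by
    rw [allBits_eq]
    exact (nodup_allVals k).map List.ofFn_injective
  have hi : (i : ℕ) < (allBits k).length := by rw [allBits_eq, List.length_map]; exact i.2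
  have := hnd.idxOf_getElem i hi
  rwa [List.getElem_of_eq (allBits_eq k), List.getElem_map, ← Fin.getElem_fin, ← he] at this

open Classical in
/-- Sets and their characteristic functions. -/
noncomputable def setEquivBool (k : ℕ) : Set (Fin k) ≃ (Fin k → Bool) where
  toFun A i := decide (i ∈ A)
  invFun v := {i | v i = true}
  left_inv A := by ext i; simp
  right_inv v := by funext i; simp

/-- The sets of states, numbered by the positions of their characteristic vectors in the list
`allVals k`. -/
noncomputable def subsetEquiv (k : ℕ) : Set (Fin k) ≃ Fin (allVals k).length :=
  (setEquivBool k).trans ((nodup_allVals k).getEquivOfForallMemList _ mem_allVals).symm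

theorem idxOf_setBits {k : ℕ} (A : Set (Fin k)) :
    (allBits k).idxOf (setBits A) = (subsetEquiv k A : ℕ) :=
  idxOf_allBits ((nodup_allVals k).getEquivOfForallMemList _ mem_allVals) (fun _ => rfl)
    (setEquivBool k A)

theorem getElem_allVals {k : ℕ} (i : Fin (allVals k).length) :
    List.ofFn (allVals k)[i] = setBits ((subsetEquiv k).symm i) :=
  ofFn_eq_setBits fun _ => Iff.rfl

theorem detTable_nfaTable {m n k : ℕ} (N : NFA (Letter m n) (Fin k)) :
    detTable (nfaTable N, allBits k) = dfaTable (DFA.reindex (subsetEquiv k) N.toDFA) := by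
  have h₁ : (nfaTable N).1 = (allLetters m n).map letterBits := rfl
  have h₂ : (nfaTable N).2.1 = k := rfl
  have h₃ : (nfaTable N).2.2.1 = setBits N.start := rfl
  have hvs : allBits k = List.ofFn fun i : Fin (allVals k).length =>
      setBits ((subsetEquiv k).symm i) := by
    rw [allBits_eq]
    apply List.ext_getElem
    · simp
    · intro i h _
      simpa using getElem_allVals ⟨i, by simpa using h⟩
  simp only [detTable, h₁, h₂, h₃, idxOf_setBits]
  conv_lhs => enter [2]; rw [hvs]
  rw [mkTable_ofFn, range_eq_ofFn]
  unfold dfaTable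
  congr 1
  · funext s a
    rw [List.map_ofFn, ofFn_eq_setBits (A := N.stepSet ((subsetEquiv k).symm s) a), idxOf_setBits]
    · rfl
    intro s'
    rw [NFA.mem_stepSet]
    simp [List.any_eq_true, nfaTable, bit_setBits]
  · funext s
    classical
    refine Bool.eq_iff_iff.2 (Iff.trans ?_ decide_eq_true_iff.symm)
    simp [nfaTable, tableOf, bit_setBits, NFA.toDFA, DFA.reindex]

/-! ### Synchronous product -/

/-- The synchronous product on tables. -/
def prodTable (p : Table ℕ × Table ℕ) : Table ℕ :=
  let (t, u) := p
  mkTable t.1 ((List.range t.2.1).flatMap fun i => (List.range u.2.1).map fun j => (i, j))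
    (t.2.2.1 * u.2.1 + u.2.2.1)
    (fun s a => entry 0 t s.1 a * u.2.1 + entry 0 u s.2 a)
    fun s => bit t.2.2.2.2.1 s.1 && bit u.2.2.2.2.1 s.2

theorem polyTime_prodTable : PolyTime prodTable := by
  unfold prodTable
  fun_prop

theorem prodTable_dfaTable {m n k₁ k₂ : ℕ} (M₁ : DFA (Letter m n) (Fin k₁))
    (M₂ : DFA (Letter m n) (Fin k₂)) :
    prodTable (dfaTable M₁, dfaTable M₂) =
      dfaTable (DFA.reindex finProdFinEquiv (M₁.inter M₂)) := by
  have h₁ : (dfaTable M₁).1 = (allLetters m n).map letterBits := rfl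
  have h₂ : (dfaTable M₁).2.1 = k₁ := rfl
  have h₃ : (dfaTable M₂).2.1 = k₂ := rfl
  have hS : ((List.range k₁).flatMap fun i => (List.range k₂).map fun j => (i, j)) =
      List.ofFn fun s : Fin (k₁ * k₂) =>
        (((finProdFinEquiv.symm s).1 : ℕ), ((finProdFinEquiv.symm s).2 : ℕ)) := by
    rw [List.ofFn_mul, List.flatMap_def, range_eq_ofFn k₁, List.map_ofFn]
    congr 2
    funext i
    rw [Function.comp_apply, range_eq_ofFn, List.map_ofFn]
    congr 1
    funext j
    have hij : (⟨i * k₂ + j, by rw [mul_comm, add_comm]; exact (finProdFinEquiv (i, j)).2⟩ :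
        Fin (k₁ * k₂)) = finProdFinEquiv (i, j) := Fin.ext (by simp; ring)
    rw [hij, Equiv.symm_apply_apply, Function.comp_apply]
  simp only [prodTable, h₁, h₂, h₃, hS]
  rw [mkTable_ofFn]
  unfold dfaTable
  congr 1
  · simp [tableOf, DFA.reindex, DFA.inter]
    ring
  · funext s a
    obtain ⟨⟨i, j⟩, rfl⟩ := finProdFinEquiv.surjective s
    simp only [DFA.reindex, DFA.inter, Equiv.coe_fn_mk, Equiv.symm_apply_apply, entry_tableOf,
      finProdFinEquiv_apply_val]
    ring
  · funext s
    obtain ⟨⟨i, j⟩, rfl⟩ := finProdFinEquiv.surjective s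
    classical
    refine Bool.eq_iff_iff.2 (Iff.trans ?_ decide_eq_true_iff.symm)
    simp only [DFA.reindex, DFA.inter, Equiv.coe_fn_mk, Set.mem_preimage, Equiv.symm_apply_apply,
      tableOf, bit_ofFn]
    simp

/-! ### The attractor of a DFA game -/

section Game

variable {m n k : ℕ} (G : DFA (Letter m n) (Fin k))

/-- The output `Y` leads from the state `s`, whatever the input, to a final state or to a state
where `T` proposes an output. -/
def Forces (T : Fin k → Option (Fin n → Bool)) (s : Fin k) (Y : Fin n → Bool) : Prop :=
  ∀ X, G.step s (X, Y) ∈ G.accept ∨ (T (G.step s (X, Y))).isSome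

open Classical in
/-- One round of the attractor computation: propose an output wherever one forces the play
into the current attractor. -/
noncomputable def attrStep (T : Fin k → Option (Fin n → Bool)) : Fin k → Option (Fin n → Bool) :=
  fun s => if (T s).isSome then T s else
    ((allLetters m n).map Prod.snd).find? fun Y => decide (Forces G T s Y)

/-- The states from which a final state can be forced within `i` steps and after at least one step,
each with an output to choose there. Once proposed, an output is never changed. -/
noncomputable def attr (i : ℕ) : Fin k → Option (Fin n → Bool) := (attrStep G)^[i] fun _ => none

theorem attr_succ (i : ℕ) : attr G (i + 1) = attrStep G (attr G i) :=
  Function.iterate_succ_apply' ..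

theorem attr_mono {i j : ℕ} (hij : i ≤ j) {s : Fin k} {Y : Fin n → Bool} (h : attr G i s = some Y) :
    attr G j s = some Y := by
  induction hij with
  | refl => exact h
  | step _ ih => simp [attr_succ, attrStep, ih]

theorem forces_of_attr {i : ℕ} {s : Fin k} {Y : Fin n → Bool} (h : attr G (i + 1) s = some Y) :
    Forces G (attr G i) s Y := by
  induction i with
  | zero =>
    rw [attr_succ, attrStep] at h
    simpa using List.find?_some h
  | succ i ih =>
    rw [attr_succ, attrStep] at h
    split_ifs at h with h'
    · intro X
      refine (ih h X).imp_right fun hs => ?_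
      obtain ⟨Z, hZ⟩ := Option.isSome_iff_exists.1 hs
      rw [attr_mono G (Nat.le_succ i) hZ]
      rfl
    · simpa using List.find?_some h

theorem exists_forces_of_attrStep {T : Fin k → Option (Fin n → Bool)} {s : Fin k}
    {Y : Fin n → Bool} (hY : Forces G T s Y) : (attrStep G T s).isSome := by
  rw [attrStep]
  split_ifs with h
  · exact h
  · rw [List.find?_isSome]
    refine ⟨Y, ?_, by simpa using hY⟩
    exact List.mem_map.2 ⟨(fun _ => false, Y), mem_allLetters _, rfl⟩

/-- As every round that changes something adds a state, `k` rounds suffice. -/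
theorem attr_stable : attrStep G (attr G k) = attr G k := by
  classical
  let c (i : ℕ) : Finset (Fin k) := Finset.univ.filter fun s => (attr G i s).isSome
  have hc (i : ℕ) : c i ⊆ c (i + 1) := by
    intro s hs
    simp only [c, Finset.mem_filter, Finset.mem_univ, true_and] at hs ⊢
    obtain ⟨Z, hZ⟩ := Option.isSome_iff_exists.1 hs
    rw [attr_mono G (Nat.le_succ i) hZ]
    rfl
  have heq (i : ℕ) (h : c (i + 1) = c i) : attr G (i + 1) = attr G i := by
    funext s
    cases hs : attr G i s with
    | some Z => exact attr_mono G (Nat.le_succ i) hs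
    | none =>
      have : s ∉ c (i + 1) := by rw [h]; simp [c, hs]
      simpa [c] using this
  have hstab (i j : ℕ) (hij : i ≤ j) (h : attr G (i + 1) = attr G i) :
      attr G (j + 1) = attr G j := by
    induction hij with
    | refl => exact h
    | step _ ih => rw [attr_succ, ih, ← attr_succ, ih]
  by_contra hne
  rw [← attr_succ] at hne
  -- Otherwise the first `k + 1` rounds all enlarge the attractor, beyond the `k` available states.
  have hcard (i : ℕ) (hi : i ≤ k + 1) : i ≤ (c i).card := by
    induction i with
    | zero => exact Nat.zero_le _
    | succ i ih =>
      have hlt : c i ⊂ c (i + 1) := (hc i).ssubset_of_ne fun h =>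
        hne (hstab i k (by omega) (heq i h.symm))
      have := Finset.card_lt_card hlt
      have := ih (by omega)
      omega
  have h₁ := hcard (k + 1) le_rfl
  have h₂ := Finset.card_le_univ (c (k + 1))
  rw [Fintype.card_fin] at h₂
  omega

/-- The first `j` rounds of a play. Unlike `play`, this may be empty. -/
def prefixOf (σ : Strategy m n) (X : ℕ → (Fin m → Bool)) (j : ℕ) : List (Letter m n) :=
  (List.range j).map fun i => (X i, σ ((List.range i).map X))

theorem eval_prefixOf_succ (σ : Strategy m n) (X : ℕ → (Fin m → Bool)) (j : ℕ) :
    G.eval (prefixOf σ X (j + 1)) =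
      G.step (G.eval (prefixOf σ X j)) (X j, σ ((List.range j).map X)) := by
  rw [prefixOf, List.range_succ, List.map_append]
  simp [prefixOf]

/-- If the attractor misses the initial state, the environment has an answer to each strategy. -/
theorem not_wins_of_attr_eq_none (h : attr G k G.start = none) (σ : Strategy m n) : ¬ Wins G σ := by
  have hbad (s : Fin k) (Y : Fin n → Bool) : ∃ X, attr G k s = none →
      G.step s (X, Y) ∉ G.accept ∧ attr G k (G.step s (X, Y)) = none := by
    by_cases hs : attr G k s = none
    · by_contra! hX
      have hY : Forces G (attr G k) s Y := fun X => by
        by_contra! hne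
        refine (hX X).2 hne.1 (by simpa using hne.2)
      have := exists_forces_of_attrStep G hY
      rw [attr_stable, hs] at this
      simp at this
    · exact ⟨fun _ => false, fun h => absurd h hs⟩
  choose answer hanswer using hbad
  -- The inputs so far and the state reached, when the environment plays `answer`.
  let hist : ℕ → List (Fin m → Bool) × Fin k := fun j => Nat.rec ([], G.start) (fun _ p =>
    (p.1 ++ [answer p.2 (σ p.1)], G.step p.2 (answer p.2 (σ p.1), σ p.1))) j
  let X (j : ℕ) : Fin m → Bool := answer (hist j).2 (σ (hist j).1)
  have hX (j : ℕ) : (List.range j).map X = (hist j).1 := by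
    induction j with
    | zero => rfl
    | succ j ih => rw [List.range_succ, List.map_append, ih]; rfl
  have heval (j : ℕ) : G.eval (prefixOf σ X j) = (hist j).2 := by
    induction j with
    | zero => rfl
    | succ j ih => rw [eval_prefixOf_succ, ih, hX]
  have hnone (j : ℕ) : attr G k (hist j).2 = none := by
    induction j with
    | zero => exact h
    | succ j ih => exact (hanswer _ _ ih).2
  intro hw
  obtain ⟨j, hj⟩ := hw X
  change G.eval (prefixOf σ X (j + 1)) ∈ _ at hj
  rw [heval] at hj
  exact (hanswer _ _ (hnone j)).1 hj

/-- The controller that follows the transitions of `G` and chooses the outputs of the attractor. -/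
noncomputable def attrController (Y₀ : Fin n → Bool) : Controller m n where
  states := k
  start := G.start
  step s X := G.step s (X, ((attr G k s).getD Y₀))
  out s := (attr G k s).getD Y₀

theorem wins_attrController (Y₀ : Fin n → Bool) (h : (attr G k G.start).isSome) :
    Wins G (attrController G Y₀).strategy := by
  intro X
  set σ := (attrController G Y₀).strategy
  have hout (w : List (Fin m → Bool)) : σ w = (attr G k
      (w.foldl (fun s X => G.step s (X, (attr G k s).getD Y₀)) G.start)).getD Y₀ := rfl
  have hst (j : ℕ) : ((List.range j).map X).foldl
      (fun s X => G.step s (X, (attr G k s).getD Y₀)) G.start = G.eval (prefixOf σ X j) := by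
    induction j with
    | zero => rfl
    | succ j ih =>
      rw [eval_prefixOf_succ, hout, ih, List.range_succ, List.map_append, List.foldl_append, ih]
      rfl
  -- By induction on the rank `i`: each step reaches a final state or lowers the rank.
  have key (i : ℕ) (hi : i ≤ k) : ∀ j, (attr G i (G.eval (prefixOf σ X j))).isSome →
      ∃ l, G.eval (prefixOf σ X (l + 1)) ∈ G.accept := by
    induction i with
    | zero => intro j hj; simp [attr] at hj
    | succ i ih =>
      intro j hj
      obtain ⟨Y, hY⟩ := Option.isSome_iff_exists.1 hj
      have hσY : σ ((List.range j).map X) = Y := by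
        rw [hout, hst, attr_mono G hi hY]
        rfl
      have := forces_of_attr G hY (X j)
      rw [← hσY, ← eval_prefixOf_succ] at this
      rcases this with h' | h'
      · exact ⟨j, h'⟩
      · exact ih (by omega) _ h'
  exact key k le_rfl 0 h

end Game

/-! ### Solving a DFA game on tables -/

/-- One round of the attractor computation on tables. -/
def attrStepTable (t : Table ℕ) (T : List (Option (List Bool))) : List (Option (List Bool)) :=
  (List.range t.2.1).map fun s =>
    bif (T[s]?.getD none).isSome then T[s]?.getD none else
      (t.1.map fun a => a.2).find? fun Y => t.1.all fun a => !(a.2 == Y) ||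
        (bit t.2.2.2.2.1 (entry 0 t s a) || (T[entry 0 t s a]?.getD none).isSome)

@[fun_prop]
theorem PolyTime.attrStepTable {t : γ → Table ℕ} {T : γ → List (Option (List Bool))}
    (ht : PolyTime t) (hT : PolyTime T) : PolyTime (fun x => attrStepTable (t x) (T x)) := by
  unfold UnreliableSynthesis.attrStepTable
  fun_prop

/-- The attractor on tables. -/
def attrTable (t : Table ℕ) : List (Option (List Bool)) :=
  (unitList t.2.1).foldl (fun T _ => attrStepTable t T) ((List.range t.2.1).map fun _ => none)

/-- Outputs are taken from the letters, so proposals do not grow from round to round. -/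
theorem esize_attrStepTable_le (t : Table ℕ) (T : List (Option (List Bool)))
    (h : ∀ o ∈ T, esize o ≤ 2 + esize t.1) :
    ∀ o ∈ attrStepTable t T, esize o ≤ 2 + esize t.1 := by
  have hget (i : ℕ) : esize (T[i]?.getD none) ≤ 2 + esize t.1 := by
    cases hi : T[i]? with
    | none => simp; omega
    | some o => exact h o (List.mem_of_getElem? hi)
  intro o ho
  obtain ⟨s, -, rfl⟩ := List.mem_map.1 ho
  cases (T[s]?.getD none).isSome with
  | true => exact hget s
  | false =>
    rw [cond_false]
    generalize hf : List.find? _ _ = r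
    cases r with
    | none => simp; omega
    | some Y =>
      obtain ⟨a, ha, rfl⟩ := List.mem_map.1 (List.mem_of_find?_eq_some hf)
      have := esize_le_of_mem ha
      obtain ⟨a₁, a₂⟩ := a
      simp at this ⊢
      omega

@[fun_prop]
theorem PolyTime.attrTable {t : γ → Table ℕ} (ht : PolyTime t) :
    PolyTime (fun x => attrTable (t x)) := by
  refine PolyTime.comp (g := UnreliableSynthesis.attrTable) (PolyTime.foldl
    (f := fun t (T : List (Option (List Bool))) (_ : Unit) => UnreliableSynthesis.attrStepTable t T)
    (by fun_prop) (by fun_prop) (by fun_prop) (1 + X * (X + 3)) fun t i => ?_) ht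
  have h₁ : ∀ u : List Unit, ∀ o ∈ u.foldl (fun T _ => UnreliableSynthesis.attrStepTable t T)
      ((List.range t.2.1).map fun _ => none), esize o ≤ 2 + esize t.1 := by
    intro u
    induction u using List.reverseRecOn with
    | nil => intro o ho; obtain ⟨_, _, rfl⟩ := List.mem_map.1 ho; simp; omega
    | append_singleton u a ih => rw [List.foldl_append]; exact esize_attrStepTable_le t _ ih
  have h₂ : ∀ u : List Unit, (u.foldl (fun T _ => UnreliableSynthesis.attrStepTable t T)
      ((List.range t.2.1).map fun _ => none)).length = t.2.1 := by
    intro u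
    induction u using List.reverseRecOn with
    | nil => simp
    | append_singleton u a ih => rw [List.foldl_append]; simp [UnreliableSynthesis.attrStepTable]
  refine (esize_list_le _ _ (h₁ _)).trans ?_
  rw [h₂]
  obtain ⟨L, k, t⟩ := t
  simp only [eval_add, eval_mul, eval_ofNat, eval_one, eval_X, esize_prod, esize_nat]
  exact Nat.add_le_add_left (Nat.mul_le_mul (by omega) (by omega)) 1

/-- The answer of the game solver on tables. -/
def solveTable (t : Table ℕ) :
    Option (List (List Bool) × ℕ × ℕ × List (List ℕ) × List (List Bool) × Unit) :=
  let T := attrTable t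
  let Y₀ := (t.1.head?.getD ([], [])).2
  let Xs := (t.1.filter fun a => a.2 == Y₀).map fun a => a.1
  bif (T[t.2.2.1]?.getD none).isSome then
    some (Xs, t.2.1, t.2.2.1,
      (List.range t.2.1).map fun s => Xs.map fun X => entry 0 t s (X, (T[s]?.getD none).getD Y₀),
      (List.range t.2.1).map fun s => (T[s]?.getD none).getD Y₀, ())
  else none

theorem polyTime_solveTable : PolyTime solveTable := by
  unfold solveTable
  fun_prop

/-- A proposal of outputs, as a list over the states. -/
def proposalBits {n k : ℕ} (T : Fin k → Option (Fin n → Bool)) : List (Option (List Bool)) :=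
  List.ofFn fun s => (T s).map List.ofFn

theorem getD_proposalBits {n k : ℕ} (T : Fin k → Option (Fin n → Bool)) (s : Fin k) :
    (proposalBits T)[(s : ℕ)]?.getD none = (T s).map List.ofFn := by
  simp [proposalBits]

theorem attrStepTable_dfaTable {m n k : ℕ} (G : DFA (Letter m n) (Fin k))
    (T : Fin k → Option (Fin n → Bool)) :
    attrStepTable (dfaTable G) (proposalBits T) = proposalBits (attrStep G T) := by
  classical
  have h₁ : (dfaTable G).1 = (allLetters m n).map letterBits := rfl
  have h₂ : (dfaTable G).2.1 = k := rfl
  have h₃ (s : Fin k) (a : Letter m n) : entry 0 (dfaTable G) s (letterBits a) = G.step s a :=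
    entry_tableOf ..
  have h₄ (s : Fin k) : bit (dfaTable G).2.2.2.2.1 s = decide (s ∈ G.accept) := by
    simp only [dfaTable, tableOf, bit_ofFn]
  rw [attrStepTable, h₂, range_eq_ofFn, List.map_ofFn, proposalBits.eq_def (attrStep G T)]
  congr 1
  funext s
  rw [Function.comp_apply, getD_proposalBits T s, attrStep, Option.isSome_map]
  cases hT : (T s).isSome with
  | true => rw [cond_true, if_pos rfl]
  | false =>
    rw [cond_false, if_neg (by simp), h₁, List.map_map,
      show (fun a => a.2) ∘ letterBits = List.ofFn ∘ (Prod.snd : Letter m n → _) from rfl,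
      ← List.map_map, List.find?_map]
    congr 2
    funext Y
    refine Bool.eq_iff_iff.2 (Iff.trans ?_ decide_eq_true_iff.symm)
    rw [Function.comp_apply, List.all_map, List.all_eq_true]
    have h₅ (a : Letter m n) := getD_proposalBits T (G.step s a)
    have h₆ (a : Letter m n) : (letterBits a).2 = List.ofFn a.2 := rfl
    simp only [Function.comp_apply, h₃, h₄, h₅, h₆, Option.isSome_map]
    constructor
    · intro h X
      simpa using h (X, Y) (mem_allLetters _)
    · rintro h ⟨X, Z⟩ -
      by_cases hZ : Z = Y
      · subst hZ
        simpa using h X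
      · simp [hZ]

theorem attrTable_dfaTable {m n k : ℕ} (G : DFA (Letter m n) (Fin k)) :
    attrTable (dfaTable G) = proposalBits (attr G k) := by
  have h (i : ℕ) : (unitList i).foldl (fun T _ => attrStepTable (dfaTable G) T)
      ((List.range k).map fun _ => none) = proposalBits (attr G i) := by
    induction i with
    | zero =>
      rw [range_eq_ofFn, List.map_ofFn]
      rfl
    | succ i ih =>
      rw [unitList, List.replicate_succ', List.foldl_append]
      rw [unitList] at ih
      rw [ih, attr_succ, ← attrStepTable_dfaTable]
      rfl
  exact h k

theorem filter_allLetters {m n : ℕ} (Y : Fin n → Bool) :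
    ((allLetters m n).filter fun a => List.ofFn a.2 == List.ofFn Y) =
      (allVals m).map fun X => (X, Y) := by
  have h (X : Fin m → Bool) : ((allVals n).map (Prod.mk X)).filter
      (fun a => List.ofFn a.2 == List.ofFn Y) = [(X, Y)] := by
    rw [List.filter_map]
    have : ((fun a : Letter m n => List.ofFn a.2 == List.ofFn Y) ∘ Prod.mk X) = (· == Y) := by
      funext Z
      exact Bool.eq_iff_iff.2 (by simp)
    rw [this, List.filter_beq, List.count_eq_one_of_mem (nodup_allVals n) (mem_allVals Y)]
    rfl
  rw [allLetters, List.product, List.filter_flatMap]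
  simp only [h]
  rw [List.map_eq_flatMap]

/-- The contents of an encoded controller. -/
def controllerTable {m n : ℕ} (C : Controller m n) :
    List (List Bool) × ℕ × ℕ × List (List ℕ) × List (List Bool) × Unit :=
  ((allVals m).map List.ofFn, C.states, (C.start : ℕ),
    List.ofFn (fun s => (allVals m).map fun X => (C.step s X : ℕ)),
    List.ofFn (fun s => List.ofFn (C.out s)), ())

theorem enc_controllerTable {m n : ℕ} (C : Controller m n) :
    enc (controllerTable C) = encController C := by
  simp only [controllerTable, enc_prod, enc_map, enc_ofFn]
  rfl

/-- The game solver decides whether the agent wins, and produces a winning controller. -/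
theorem exists_solveTable_dfaTable {m n k : ℕ} (G : DFA (Letter m n) (Fin k)) :
    ∃ r : Option (Controller m n), enc (solveTable (dfaTable G)) = encAnswer r ∧
      (∀ C, r = some C → Wins G C.strategy) ∧
      (r = none → ¬ ∃ σ : Strategy m n, Wins G σ) := by
  have h₁ : (dfaTable G).1 = (allLetters m n).map letterBits := rfl
  have h₂ : (dfaTable G).2.1 = k := rfl
  have h₃ : (dfaTable G).2.2.1 = G.start := rfl
  have hT (s : Fin k) := getD_proposalBits (attr G k) s
  obtain ⟨a₀, ha₀⟩ : ∃ a₀, (allLetters m n).head? = some a₀ :=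
    ⟨_, List.head?_eq_some_head
      (List.ne_nil_of_mem (mem_allLetters (fun _ => false, fun _ => false)))⟩
  have hY₀ : (((allLetters m n).map letterBits).head?.getD ([], [])).2 = List.ofFn a₀.2 := by
    rw [List.head?_map, ha₀]
    rfl
  have hXs : (((allLetters m n).map letterBits).filter fun a => a.2 == List.ofFn a₀.2).map
      (fun a => a.1) = (allVals m).map List.ofFn := by
    rw [List.filter_map, show ((fun a : List Bool × List Bool => a.2 == List.ofFn a₀.2) ∘ letterBits) =
      fun a : Letter m n => List.ofFn a.2 == List.ofFn a₀.2 from rfl, filter_allLetters,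
      List.map_map, List.map_map]
    rfl
  have hout (s : Fin k) : ((attr G k s).map List.ofFn).getD (List.ofFn a₀.2) =
      List.ofFn ((attr G k s).getD a₀.2) := by cases attr G k s <;> rfl
  have key : solveTable (dfaTable G) = bif (attr G k G.start).isSome then
      some (controllerTable (attrController G a₀.2)) else none := by
    simp only [solveTable, h₁, h₂, h₃, hY₀, hXs, attrTable_dfaTable, hT, Option.isSome_map]
    congr 2
    simp only [range_eq_ofFn, List.map_ofFn, controllerTable, Function.comp_def, hT, hout,
      List.map_map]
    congr 4
    refine congrArg List.ofFn (funext fun s =>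
      congrArg (fun f => (allVals m).map f) (funext fun X => ?_))
    exact entry_tableOf _ _ _ _ s (X, (attr G k s).getD a₀.2)
  rw [key]
  cases h : (attr G k G.start).isSome with
  | true =>
    refine ⟨some (attrController G a₀.2), ?_, ?_, nofun⟩
    · rw [cond_true, enc_some, enc_controllerTable]
      rfl
    · rintro _ ⟨⟩
      exact wins_attrController G _ h
  | false =>
    refine ⟨none, rfl, nofun, fun _ => ?_⟩
    rintro ⟨σ, hσ⟩
    exact not_wins_of_attr_eq_none G (by simpa using h) σ hσ

/-! ### Formulas as data -/

theorem encFormula_injective {m n : ℕ} : Function.Injective (encFormula (m := m) (n := n)) := by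
  intro φ
  induction φ with
  | var A =>
    rintro (B | _ | _ | _ | _) h <;> rcases A with i | i
    · rcases B with j | j <;> simp [encFormula, encNat] at h
      rw [Fin.ext (encNat_injective h)]
    · rcases B with j | j <;> simp [encFormula, encNat] at h
      rw [Fin.ext (encNat_injective h)]
    all_goals simp [encFormula, encNat] at h
  | neg φ ih =>
    rintro ((j | j) | ψ | _ | _ | _) h <;> simp [encFormula, encNat] at h
    rw [ih h]
  | and φ ψ ih₁ ih₂ =>
    rintro ((j | j) | _ | ⟨φ', ψ'⟩ | _ | _) h <;> simp [encFormula, encNat] at h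
    rw [ih₁ h.1, ih₂ h.2]
  | next φ ih =>
    rintro ((j | j) | _ | _ | ψ | _) h <;> simp [encFormula, encNat] at h
    rw [ih h]
  | untl φ ψ ih₁ ih₂ =>
    rintro ((j | j) | _ | _ | _ | ⟨φ', ψ'⟩) h <;> simp [encFormula, encNat] at h
    rw [ih₁ h.1, ih₂ h.2]

/-- A formula together with the numbers of input and output variables. -/
abbrev Spec : Type := (m : ℕ) × (n : ℕ) × Formula m n

instance : Enc Spec :=
  ⟨fun x => encSpec x.2.2, fun ⟨m, n, φ⟩ ⟨m', n', φ'⟩ h => by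
    simp only [encSpec, Data.cons.injEq] at h
    obtain ⟨h₁, h₂, h₃⟩ := h
    obtain rfl := encNat_injective h₁
    obtain rfl := encNat_injective h₂
    rw [encFormula_injective h₃]⟩

theorem polyTime_spec : PolyTime fun x : Spec => (x.1, x.2.1, encFormula x.2.2) :=
  .of_enc_eq fun _ => rfl

noncomputable instance : DecidableEq Data := Classical.decEq _

/-- The first component. -/
def Data.fst : Data → Data
  | .nil => .nil
  | .cons a _ => a

/-- The second component. -/
def Data.snd : Data → Data
  | .nil => .nil
  | .cons _ b => b

@[fun_prop]
theorem PolyTime.dataFst {f : γ → Data} (hf : PolyTime f) : PolyTime (fun x => (f x).fst) :=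
  PolyTime.comp (g := Data.fst) ⟨.hd, X, fun x => by
    rw [eval_X]
    cases x with
    | nil => exact ⟨_, le_rfl, .hd_nil⟩
    | cons a b => exact .hd a b⟩ hf

@[fun_prop]
theorem PolyTime.dataSnd {f : γ → Data} (hf : PolyTime f) : PolyTime (fun x => (f x).snd) :=
  PolyTime.comp (g := Data.snd) ⟨.tl, X, fun x => by
    rw [eval_X]
    cases x with
    | nil => exact ⟨_, le_rfl, .tl_nil⟩
    | cons a b => exact .tl a b⟩ hf

@[fun_prop]
theorem PolyTime.enc {f : γ → α} (hf : PolyTime f) : PolyTime (fun x => enc (f x)) :=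
  hf.congr fun _ => rfl

/-! ### The list of subformulas -/

/-- The immediate subformulas. -/
def children {V : Type} : LTLf V → List (LTLf V)
  | .var _ => []
  | .neg φ => [φ]
  | .and φ ψ => [φ, ψ]
  | .next φ => [φ]
  | .untl φ ψ => [φ, ψ]

/-- The occurrences of subformulas, in prefix order. -/
def subs {V : Type} : LTLf V → List (LTLf V)
  | .var A => [.var A]
  | .neg φ => .neg φ :: subs φ
  | .and φ ψ => .and φ ψ :: (subs φ ++ subs ψ)
  | .next φ => .next φ :: subs φ
  | .untl φ ψ => .untl φ ψ :: (subs φ ++ subs ψ)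

theorem subs_eq {V : Type} (φ : LTLf V) : subs φ = φ :: (children φ).flatMap subs := by
  cases φ <;> simp [subs, children]

theorem mem_subs_self {V : Type} (φ : LTLf V) : φ ∈ subs φ := by
  rw [subs_eq]
  exact List.mem_cons_self

theorem mem_subs_trans {V : Type} {φ ψ χ : LTLf V} (h : ψ ∈ subs φ) (h' : χ ∈ subs ψ) :
    χ ∈ subs φ := by
  induction φ with
  | var A =>
    rw [subs, List.mem_singleton] at h
    rwa [h] at h'
  | neg φ ih | next φ ih =>
    rcases List.mem_cons.1 h with rfl | h
    · exact h'
    · exact List.mem_cons_of_mem _ (ih h)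
  | and φ₁ φ₂ ih₁ ih₂ | untl φ₁ φ₂ ih₁ ih₂ =>
    rcases List.mem_cons.1 h with rfl | h
    · exact h'
    · refine List.mem_cons_of_mem _ (List.mem_append.2 ?_)
      exact (List.mem_append.1 h).imp ih₁ ih₂

theorem mem_subs_of_mem_children {V : Type} {φ ψ χ : LTLf V} (h : ψ ∈ subs φ)
    (h' : χ ∈ children ψ) : χ ∈ subs φ := by
  refine mem_subs_trans h ?_
  rw [subs_eq]
  exact List.mem_cons_of_mem _ (List.mem_flatMap.2 ⟨χ, h', mem_subs_self χ⟩)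

theorem length_subs_le {m n : ℕ} (φ : Formula m n) : (subs φ).length ≤ (encFormula φ).size := by
  induction φ with
  | var A => rcases A with i | i <;> simp [subs, encFormula, Data.size] <;> omega
  | neg φ ih | next φ ih => simp [subs, encFormula, Data.size]; omega
  | and φ ψ ih₁ ih₂ | untl φ ψ ih₁ ih₂ => simp [subs, encFormula, Data.size]; omega

theorem size_le_of_mem_subs {m n : ℕ} {φ ψ : Formula m n} (h : ψ ∈ subs φ) :
    (encFormula ψ).size ≤ (encFormula φ).size := by
  induction φ with
  | var A =>
    rw [subs, List.mem_singleton] at h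
    rw [h]
  | neg φ ih | next φ ih =>
    rcases List.mem_cons.1 h with rfl | h
    · exact le_rfl
    · have := ih h
      simp [encFormula, Data.size]; omega
  | and φ₁ φ₂ ih₁ ih₂ | untl φ₁ φ₂ ih₁ ih₂ =>
    rcases List.mem_cons.1 h with rfl | h
    · exact le_rfl
    · have := (List.mem_append.1 h).imp ih₁ ih₂
      simp [encFormula, Data.size]; omega

/-- The immediate subformulas of an encoded formula. -/
noncomputable def childrenData (d : Data) : List Data :=
  bif decide (d.fst = enc 0) then [] else
    bif decide (d.fst = enc 1) || decide (d.fst = enc 3) then [d.snd] else [d.snd.fst, d.snd.snd]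

theorem childrenData_encFormula {m n : ℕ} (φ : Formula m n) :
    childrenData (encFormula φ) = (children φ).map encFormula := by
  rcases φ with (i | i) | _ | _ | _ | _ <;>
    simp [childrenData, encFormula, Data.fst, Data.snd, children, Enc.enc, encNat]

/-- One step of the traversal of a formula: the first formula of the agenda is moved to the result,
and its immediate subformulas take its place. -/
noncomputable def visit (s : List Data × List Data) : List Data × List Data :=
  listCase s (fun d w => (childrenData d ++ w, d :: s.2)) s.1

theorem polyTime_visit : PolyTime visit := by
  unfold visit childrenData
  fun_prop

/-- The traversal keeps the subformulas already visited, followed by those below the agenda, equal to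
`subs φ`. -/
theorem iterate_visit {m n : ℕ} (φ : Formula m n) (i : ℕ) (hi : i ≤ (subs φ).length) :
    ∃ w acc : List (Formula m n), acc.reverse ++ w.flatMap subs = subs φ ∧ acc.length = i ∧
      visit^[i] ([encFormula φ], []) = (w.map encFormula, acc.map encFormula) := by
  induction i with
  | zero => exact ⟨[φ], [], by simp⟩
  | succ i ih =>
    obtain ⟨w, acc, h₁, h₂, h₃⟩ := ih (by omega)
    cases w with
    | nil =>
      have := congrArg List.length h₁
      simp at this
      omega
    | cons ψ w =>
      refine ⟨children ψ ++ w, ψ :: acc, ?_, by simp [h₂], ?_⟩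
      · rw [← h₁, List.flatMap_cons, subs_eq ψ]
        simp
      · rw [Function.iterate_succ_apply', h₃]
        simp [visit, listCase, childrenData_encFormula]

/-- The list of the encoded subformulas. -/
def subsData (x : Spec) : List Data := (subs x.2.2).map encFormula

theorem polyTime_subsData : PolyTime subsData := by
  have hz : PolyTime fun x : Spec => ([encFormula x.2.2], ([] : List Data)) :=
    PolyTime.comp (g := fun p : ℕ × ℕ × Data => ([p.2.2], [])) (by fun_prop) polyTime_spec
  have hsize (x : Spec) : (encFormula x.2.2).size ≤ esize x := by
    change _ ≤ (encSpec x.2.2).size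
    simp [encSpec, Data.size]
    omega
  have hlen (x : Spec) : (subs x.2.2).length ≤ esize x := (length_subs_le _).trans (hsize x)
  have hsub (x : Spec) (l : List (Formula x.1 x.2.1)) (h : ∀ ψ ∈ l, ψ ∈ subs x.2.2)
      (hl : l.length ≤ (subs x.2.2).length) :
      esize (l.map encFormula) ≤ 1 + esize x * (esize x + 1) := by
    refine (esize_list_le _ (esize x) fun d hd => ?_).trans ?_
    · obtain ⟨ψ, hψ, rfl⟩ := List.mem_map.1 hd
      exact (size_le_of_mem_subs (h ψ hψ)).trans (hsize x)
    · rw [List.length_map]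
      gcongr
      exact hl.trans (hlen x)
  have key := TimeIn.iterate_while (B := esize) hz
    (c := fun s => listCase false (fun _ _ => true) s.1) (by fun_prop) polyTime_visit
    (fun x => (subs x.2.2).length) (3 + 2 * X * (X + 1) + X)
    (fun x i hi => by
      obtain ⟨w, acc, h₁, h₂, h₃⟩ := iterate_visit x.2.2 i hi
      rw [h₃]
      have hw : w.length ≤ (w.flatMap subs).length := by
        rw [List.length_flatMap]
        clear h₁ h₂ h₃
        induction w with
        | nil => simp
        | cons ψ w ih =>
          have : 0 < (subs ψ).length := List.length_pos_of_mem (mem_subs_self ψ)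
          simp only [List.map_cons, List.sum_cons, List.length_cons]
          omega
      have hlen' := congrArg List.length h₁
      simp only [List.length_append, List.length_reverse] at hlen'
      have e₁ := hsub x w (fun ψ hψ => h₁ ▸ List.mem_append_right _
        (List.mem_flatMap.2 ⟨ψ, hψ, mem_subs_self ψ⟩)) (by omega)
      have e₂ := hsub x acc (fun ψ hψ => h₁ ▸ List.mem_append_left _ (List.mem_reverse.2 hψ))
        (by omega)
      simp only [esize_prod, eval_add, eval_mul, eval_X, eval_ofNat, eval_one]
      linarith)
    (fun x => by
      simp only [eval_add, eval_mul, eval_X, eval_ofNat, eval_one]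
      have := hlen x
      omega)
    (fun x i hi => by
      obtain ⟨w, acc, h₁, h₂, h₃⟩ := iterate_visit x.2.2 i hi.le
      rw [h₃]
      cases w with
      | nil =>
        have := congrArg List.length h₁
        simp at this
        omega
      | cons ψ w => rfl)
    (fun x => by
      obtain ⟨w, acc, h₁, h₂, h₃⟩ := iterate_visit x.2.2 _ le_rfl
      rw [h₃]
      cases w with
      | nil => rfl
      | cons ψ w =>
        have := congrArg List.length h₁
        rw [List.flatMap_cons, subs_eq ψ] at this
        simp at this
        omega)
  refine TimeIn.congr (TimeIn.comp (g := fun s : List Data × List Data => s.2.reverse)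
    (by fun_prop) key) fun x => ?_
  obtain ⟨w, acc, h₁, h₂, h₃⟩ := iterate_visit x.2.2 _ le_rfl
  rw [h₃]
  have : w = [] := by
    cases w with
    | nil => rfl
    | cons ψ w =>
      have := congrArg List.length h₁
      rw [List.flatMap_cons, subs_eq ψ] at this
      simp at this
      omega
  subst this
  rw [List.flatMap_nil, List.append_nil] at h₁
  rw [subsData, ← h₁, List.map_reverse]

/-! ### Truth along a trace -/

/-- The formula `φ` holds at the start of `t`; at the end of a trace nothing holds. -/
def Holds {m n : ℕ} (t : List (Letter m n)) (φ : Formula m n) : Prop := t ≠ [] ∧ Models t φ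

theorem sat_cons_succ {V : Type} (a : V → Bool) (t : List (V → Bool)) (φ : LTLf V) (i : ℕ) :
    LTLf.Sat (a :: t) (i + 1) φ ↔ LTLf.Sat t i φ := by
  induction φ generalizing i with
  | var A => simp [LTLf.Sat]
  | neg φ ih => simp [LTLf.Sat, ih]
  | and φ ψ ih₁ ih₂ => simp [LTLf.Sat, ih₁, ih₂]
  | next φ ih => simp [LTLf.Sat, ih]
  | untl φ ψ ih₁ ih₂ =>
    simp only [LTLf.Sat]
    constructor
    · rintro ⟨j, h₁, h₂, h₃, h₄⟩
      obtain ⟨j, rfl⟩ : ∃ l, j = l + 1 := ⟨j - 1, by omega⟩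
      refine ⟨j, by omega, by simpa using h₂, (ih₂ j).1 h₃, fun k hk hkj => ?_⟩
      exact (ih₁ k).1 (h₄ (k + 1) (by omega) (by omega))
    · rintro ⟨j, h₁, h₂, h₃, h₄⟩
      refine ⟨j + 1, by omega, by simpa using h₂, (ih₂ j).2 h₃, fun k hk hkj => ?_⟩
      obtain ⟨k, rfl⟩ : ∃ l, k = l + 1 := ⟨k - 1, by omega⟩
      exact (ih₁ k).2 (h₄ k (by omega) (by omega))

section Holds

variable {m n : ℕ} (a : Letter m n) (t : List (Letter m n)) (φ ψ : Formula m n)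

theorem holds_cons_var (A : Fin m ⊕ Fin n) :
    Holds (a :: t) (.var A) ↔ Sum.elim a.1 a.2 A = true := by
  simp [Holds, Models, LTLf.Sat]

theorem holds_cons_neg : Holds (a :: t) (.neg φ) ↔ ¬ Holds (a :: t) φ := by
  simp [Holds, Models, LTLf.Sat]

theorem holds_cons_and : Holds (a :: t) (.and φ ψ) ↔ Holds (a :: t) φ ∧ Holds (a :: t) ψ := by
  simp [Holds, Models, LTLf.Sat]

theorem holds_cons_next : Holds (a :: t) (.next φ) ↔ Holds t φ := by
  simp only [Holds, Models, LTLf.Sat, List.map_cons, sat_cons_succ]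
  simp [List.length_pos_iff]

theorem holds_cons_untl : Holds (a :: t) (.untl φ ψ) ↔
    Holds (a :: t) ψ ∨ (Holds (a :: t) φ ∧ Holds t (.untl φ ψ)) := by
  simp only [Holds, Models, LTLf.Sat, List.map_cons]
  constructor
  · rintro ⟨-, j, -, h₂, h₃, h₄⟩
    cases j with
    | zero => exact .inl ⟨by simp, h₃⟩
    | succ j =>
      refine .inr ⟨⟨by simp, h₄ 0 le_rfl (by omega)⟩, ?_, j, Nat.zero_le _, by simpa using h₂,
        (sat_cons_succ ..).1 h₃, fun k _ hk => (sat_cons_succ ..).1 (h₄ (k + 1) (by omega) (by omega))⟩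
      rintro rfl
      simp at h₂
  · rintro (⟨-, h⟩ | ⟨⟨-, h⟩, -, j, -, h₂, h₃, h₄⟩)
    · exact ⟨by simp, 0, le_rfl, by simp, h, fun k _ hk => absurd hk (by omega)⟩
    · refine ⟨by simp, j + 1, by omega, by simpa using h₂, (sat_cons_succ ..).2 h₃,
        fun k _ hk => ?_⟩
      cases k with
      | zero => exact h
      | succ k => exact (sat_cons_succ ..).2 (h₄ k (by omega) (by omega))

end Holds

/-! ### The automaton of guessed truth values -/

/-- The value that the bit list `v` gives to the key `d` among the keys `D`. -/
noncomputable def valueAt (D : List Data) (v : List Bool) (d : Data) : Bool :=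
  ((D.zip v).lookup d).getD false

@[fun_prop]
theorem PolyTime.valueAt {D : γ → List Data} {v : γ → List Bool} {d : γ → Data} (hD : PolyTime D)
    (hv : PolyTime v) (hd : PolyTime d) : PolyTime (fun x => valueAt (D x) (v x) (d x)) := by
  unfold UnreliableSynthesis.valueAt
  fun_prop

/-- The truth value of the encoded formula `d`, when the letter is `a` and its subformulas have the
values `v` now and `v'` at the next position. -/
noncomputable def evalData (D : List Data) (v v' : List Bool) (a : List Bool × List Bool)
    (d : Data) : Bool :=
  bif decide (d.fst = enc 0) then
    bif decide (d.snd.fst = enc 0) then valueAt ((List.range a.1.length).map enc) a.1 d.snd.snd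
    else valueAt ((List.range a.2.length).map enc) a.2 d.snd.snd
  else bif decide (d.fst = enc 1) then !valueAt D v d.snd
  else bif decide (d.fst = enc 2) then valueAt D v d.snd.fst && valueAt D v d.snd.snd
  else bif decide (d.fst = enc 3) then valueAt D v' d.snd
  else valueAt D v d.snd.snd || (valueAt D v d.snd.fst && valueAt D v' d)

@[fun_prop]
theorem PolyTime.evalData {D : γ → List Data} {v v' : γ → List Bool} {a : γ → List Bool × List Bool}
    {d : γ → Data} (hD : PolyTime D) (hv : PolyTime v) (hv' : PolyTime v') (ha : PolyTime a)
    (hd : PolyTime d) : PolyTime (fun x => evalData (D x) (v x) (v' x) (a x) (d x)) := by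
  unfold UnreliableSynthesis.evalData
  fun_prop

/-- The values `v` are those determined by the letter `a` and the values `v'` at the next
position. -/
noncomputable def consistent (D : List Data) (v v' : List Bool) (a : List Bool × List Bool) : Bool :=
  (D.zip v).all fun p => p.2 == evalData D v v' a p.1

/-- The table of the automaton that guesses the truth values of the subformulas `D` at all
positions, starting with those at which `d` is false. The values past the end are all false. -/
noncomputable def guessTable (p : (List Data × Data) × List (List Bool × List Bool) × List (List Bool)) :
    Table (List Bool) :=
  mkTable p.2.1 p.2.2 (p.2.2.map fun v => !valueAt p.1.1 v p.1.2)
    (fun v a => p.2.2.map fun v' => consistent p.1.1 v v' a) fun v => v.all fun b => !b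

theorem polyTime_guessTable : PolyTime guessTable := by
  unfold guessTable consistent
  fun_prop

theorem lookup_zip_of_mem {D : List Data} {v : List Bool} (h : v.length = D.length) {d : Data}
    (hd : d ∈ D) : (d, valueAt D v d) ∈ D.zip v := by
  induction D generalizing v with
  | nil => simp at hd
  | cons c D ih =>
    cases v with
    | nil => simp at h
    | cons b v =>
      rw [valueAt, List.zip_cons_cons, List.lookup_cons]
      by_cases hc : d = c
      · subst hc; simp
      · rw [beq_eq_false_iff_ne.2 hc]
        exact List.mem_cons_of_mem _ (ih (by simpa using h) ((List.mem_cons.1 hd).resolve_left hc))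

theorem valueAt_range {k : ℕ} (f : Fin k → Bool) (i : Fin k) :
    valueAt ((List.range (List.ofFn f).length).map enc) (List.ofFn f) (encNat i) = f i := by
  have := lookup_zip_map (r := enc ∘ fun i : Fin k => (i : ℕ))
    (fun i j h => Fin.ext (encNat_injective h)) f (List.mem_finRange i)
  rw [List.length_ofFn, range_eq_ofFn, List.map_ofFn, List.ofFn_eq_map, List.ofFn_eq_map, valueAt]
  exact congrArg (fun o => o.getD false) this

section Guess

variable {m n : ℕ} (φ : Formula m n)

open Classical in
/-- The truth values of the subformulas of `φ` at the start of `t`. -/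
noncomputable def truth (t : List (Letter m n)) : List Bool :=
  (subs φ).map fun ψ => decide (Holds t ψ)

theorem valueAt_truth (t : List (Letter m n)) {ψ : Formula m n} (h : ψ ∈ subs φ) :
    valueAt ((subs φ).map encFormula) (truth φ t) (encFormula ψ) = true ↔ Holds t ψ := by
  classical
  rw [valueAt, truth, lookup_zip_map encFormula_injective _ h]
  simp

/-- The local rules of `evalData` are the semantics of the connectives: at the letter `a`, a formula
gets its value from its immediate subformulas, and from the values at the start of `t`. -/
theorem evalData_iff (t : List (Letter m n)) (a : Letter m n) (v : List Bool) {ψ : Formula m n}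
    (hψ : ψ ∈ subs φ) (h : ∀ χ ∈ children ψ,
      valueAt ((subs φ).map encFormula) v (encFormula χ) = true ↔ Holds (a :: t) χ) :
    evalData ((subs φ).map encFormula) v (truth φ t) (letterBits a) (encFormula ψ) = true ↔
      Holds (a :: t) ψ := by
  have hv (χ) (hχ : χ ∈ subs φ) := valueAt_truth φ t hχ
  rcases ψ with (i | i) | χ | ⟨χ₁, χ₂⟩ | χ | ⟨χ₁, χ₂⟩
  · rw [holds_cons_var, Sum.elim_inl, ← valueAt_range a.1 i]
    simp [evalData, encFormula, Data.fst, Data.snd, Enc.enc, encNat, letterBits]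
  · rw [holds_cons_var, Sum.elim_inr, ← valueAt_range a.2 i]
    simp [evalData, encFormula, Data.fst, Data.snd, Enc.enc, encNat, letterBits]
  · rw [holds_cons_neg, ← h χ (by simp [children])]
    simp [evalData, encFormula, Data.fst, Data.snd, Enc.enc, encNat]
  · rw [holds_cons_and, ← h χ₁ (by simp [children]), ← h χ₂ (by simp [children])]
    simp [evalData, encFormula, Data.fst, Data.snd, Enc.enc, encNat]
  · rw [holds_cons_next, ← hv χ (mem_subs_of_mem_children hψ (by simp [children]))]
    simp [evalData, encFormula, Data.fst, Data.snd, Enc.enc, encNat]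
  · rw [holds_cons_untl, ← h χ₁ (by simp [children]), ← h χ₂ (by simp [children]), ← hv _ hψ]
    simp [evalData, encFormula, Data.fst, Data.snd, Enc.enc, encNat]

/-- Consistency determines the truth values from those at the next position. -/
theorem consistent_truth_iff (t : List (Letter m n)) (a : Letter m n) {v : List Bool}
    (hv : v.length = (subs φ).length) :
    consistent ((subs φ).map encFormula) v (truth φ t) (letterBits a) = true ↔
      v = truth φ (a :: t) := by
  have hlen : v.length = ((subs φ).map encFormula).length := by rw [hv, List.length_map]
  rw [consistent, List.all_eq_true]
  constructor
  · intro h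
    have hstep (ψ : Formula m n) (hψ : ψ ∈ subs φ) (hc : ∀ χ ∈ children ψ,
        valueAt ((subs φ).map encFormula) v (encFormula χ) = true ↔ Holds (a :: t) χ) :
        valueAt ((subs φ).map encFormula) v (encFormula ψ) = true ↔ Holds (a :: t) ψ := by
      have := h _ (lookup_zip_of_mem hlen (List.mem_map_of_mem hψ))
      simp only [beq_iff_eq] at this
      rw [this]
      exact evalData_iff φ t a v hψ hc
    have key (ψ : Formula m n) (hψ : ψ ∈ subs φ) :
        valueAt ((subs φ).map encFormula) v (encFormula ψ) = true ↔ Holds (a :: t) ψ := by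
      refine hstep ψ hψ ?_
      induction ψ with
      | var A => simp [children]
      | neg χ ih | next χ ih =>
        have hχ := mem_subs_of_mem_children hψ (χ := χ) (by simp [children])
        simpa [children] using hstep χ hχ (ih hχ)
      | and χ₁ χ₂ ih₁ ih₂ | untl χ₁ χ₂ ih₁ ih₂ =>
        have h₁ := mem_subs_of_mem_children hψ (χ := χ₁) (by simp [children])
        have h₂ := mem_subs_of_mem_children hψ (χ := χ₂) (by simp [children])
        simpa [children] using ⟨hstep χ₁ h₁ (ih₁ h₁), hstep χ₂ h₂ (ih₂ h₂)⟩
    classical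
    refine List.ext_getElem (by simp [truth, hv]) fun i h₁ h₂ => ?_
    have hi : i < (subs φ).length := by omega
    have := h (((subs φ).map encFormula)[i]'(by simpa using hi), v[i])
      (List.mem_iff_getElem.2 ⟨i, by simp [hv, hi], by simp⟩)
    simp only [beq_iff_eq] at this
    rw [this, List.getElem_map]
    have hi' : (subs φ)[i] ∈ subs φ := List.getElem_mem hi
    simp only [truth, List.getElem_map]
    exact Bool.eq_iff_iff.2 ((evalData_iff φ t a v hi' fun χ hχ =>
      key χ (mem_subs_of_mem_children hi' hχ)).trans decide_eq_true_iff.symm)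
  · rintro rfl p hp
    classical
    rw [truth, List.zip_map', List.mem_map] at hp
    obtain ⟨ψ, hψ, rfl⟩ := hp
    rw [beq_iff_eq]
    exact Bool.eq_iff_iff.2 (decide_eq_true_iff.trans (evalData_iff φ t a _ hψ fun χ hχ =>
      valueAt_truth φ _ (mem_subs_of_mem_children hψ hχ)).symm)

/-- The automaton of guessed truth values, its states numbered by their positions in the list
`allVals`. -/
noncomputable def guessNFA : NFA (Letter m n) (Fin (allVals (subs φ).length).length) where
  step s a := {s' | consistent ((subs φ).map encFormula) (List.ofFn (allVals (subs φ).length)[s])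
    (List.ofFn (allVals (subs φ).length)[s']) (letterBits a) = true}
  start := {s | valueAt ((subs φ).map encFormula) (List.ofFn (allVals (subs φ).length)[s])
    (encFormula φ) = false}
  accept := {s | ((List.ofFn (allVals (subs φ).length)[s]).all fun b => !b) = true}

/-- Every assignment of truth values is a state. -/
theorem exists_state {v : List Bool} (h : v.length = (subs φ).length) :
    ∃ s : Fin (allVals (subs φ).length).length, List.ofFn (allVals (subs φ).length)[s] = v := by
  have := mem_allBits_iff.2 h
  rw [allBits_eq, List.mem_map] at this
  obtain ⟨w, hw, rfl⟩ := this
  obtain ⟨i, hi, rfl⟩ := List.mem_iff_getElem.1 hw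
  exact ⟨⟨i, hi⟩, rfl⟩

/-- A state accepts just the traces with the truth values that it guesses. -/
theorem mem_acceptsFrom_guessNFA (t : List (Letter m n))
    (s : Fin (allVals (subs φ).length).length) :
    t ∈ (guessNFA φ).acceptsFrom {s} ↔ List.ofFn (allVals (subs φ).length)[s] = truth φ t := by
  induction t generalizing s with
  | nil =>
    rw [NFA.nil_mem_acceptsFrom]
    have : truth φ [] = List.replicate (subs φ).length false := by
      simp [truth, Holds]
    rw [this, List.eq_replicate_iff]
    simp only [guessNFA, Set.mem_singleton_iff, exists_eq_left]
    simp
  | cons a t ih =>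
    rw [NFA.cons_mem_acceptsFrom, NFA.stepSet_singleton, ← consistent_truth_iff φ t a (by simp)]
    obtain ⟨s', hs'⟩ := exists_state φ (v := truth φ t) (by simp [truth])
    rw [NFA.mem_acceptsFrom]
    constructor
    · rintro ⟨f, hf, hs⟩
      obtain ⟨s'', h₁, h₂⟩ := NFA.mem_evalFrom_iff_exists.1 hs
      rw [← (ih s'').1 ⟨f, hf, h₂⟩]
      exact h₁
    · intro h
      obtain ⟨f, hf, hs⟩ := (ih s').2 hs'
      refine ⟨f, hf, NFA.mem_evalFrom_iff_exists.2 ⟨s', ?_, hs⟩⟩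
      rw [← hs'] at h
      exact h

theorem recognizes_guessNFA : Recognizes (guessNFA φ).accepts (.neg φ) := by
  intro t ht
  have hM : Models t (.neg φ) ↔ ¬ Holds t φ := by simp [Holds, ht, Models, LTLf.Sat]
  rw [hM, ← valueAt_truth φ t (mem_subs_self φ), Bool.not_eq_true]
  obtain ⟨s, hs⟩ := exists_state φ (v := truth φ t) (by simp [truth])
  constructor
  · rintro ⟨f, hf, hs⟩
    obtain ⟨s', h₁, h₂⟩ := NFA.mem_evalFrom_iff_exists.1 hs
    rw [← (mem_acceptsFrom_guessNFA φ t s').1 ⟨f, hf, h₂⟩]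
    exact h₁
  · intro h
    obtain ⟨f, hf, hs'⟩ := (mem_acceptsFrom_guessNFA φ t s).2 hs
    refine ⟨f, hf, NFA.mem_evalFrom_iff_exists.2 ⟨s, ?_, hs'⟩⟩
    rw [← hs] at h
    exact h

theorem guessTable_eq : guessTable (((subs φ).map encFormula, encFormula φ),
    (allLetters m n).map letterBits, allBits (subs φ).length) = nfaTable (guessNFA φ) := by
  have hvs : allBits (subs φ).length = List.ofFn fun i : Fin (allVals (subs φ).length).length =>
      List.ofFn (allVals (subs φ).length)[i] := by
    rw [allBits_eq]
    apply List.ext_getElem <;> simp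
  simp only [guessTable, hvs]
  rw [mkTable_ofFn]
  unfold nfaTable
  congr 1
  · rw [List.map_ofFn]
    exact ofFn_eq_setBits fun i => by simp [guessNFA]
  · funext s a
    rw [List.map_ofFn]
    exact ofFn_eq_setBits fun i => Iff.rfl
  · funext s
    classical
    refine Bool.eq_iff_iff.2 (Iff.trans ?_ decide_eq_true_iff.symm)
    exact Iff.rfl

end Guess

/-! ### Running time of the automaton construction -/

/-- Precomposition with a polynomial-time function `f`, where the measure of `f x` is bounded by that
of `x`. -/
theorem TimeIn.precomp {B : β → ℕ} {B' : α → ℕ} {f : α → β} {g : β → γ} (hg : TimeIn B g)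
    (hf : PolyTime f) (hB : ∀ x, B (f x) ≤ B' x) (hs : ∀ x, esize x ≤ B' x) :
    TimeIn B' (fun x => g (f x)) := by
  obtain ⟨p, P, hp⟩ := hf
  obtain ⟨q, Q, hq⟩ := hg
  refine ⟨.seq p q, X + P + Q, fun x => ((hp x).seq (hq (f x))).mono ?_⟩
  have := eval_mono P (hs x)
  have := eval_mono Q (hB x)
  have := hs x
  simp only [eval_add, eval_X]
  unfold esize at *
  omega

theorem allLetters_eq_allBits (m n : ℕ) : (allLetters m n).map letterBits =
    (allBits m).flatMap fun x => (allBits n).map fun y => (x, y) := by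
  simp [allLetters, List.product, allBits_eq, List.map_flatMap, List.flatMap_map, letterBits,
    Function.comp_def]

theorem TimeIn.allBits {f : α → ℕ} (hf : PolyTime f) (h : ∀ x, f x ≤ esize x) :
    TimeIn (fun x => 2 ^ esize x) fun x => allBits (f x) :=
  timeIn_allBits.precomp hf (fun x => Nat.pow_le_pow_right (by norm_num) (h x))
    fun _ => Nat.lt_two_pow_self.le

theorem timeIn_guess : TimeIn (fun x : Spec => 2 ^ esize x) fun x => nfaTable (guessNFA x.2.2) := by
  have hspec := polyTime_spec
  have h₁ : PolyTime fun x : Spec => x.1 := hspec.fst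
  have h₂ : PolyTime fun x : Spec => x.2.1 := hspec.snd.fst
  have h₃ : PolyTime fun x : Spec => encFormula x.2.2 := hspec.snd.snd
  have hsz (x : Spec) : x.1 ≤ esize x ∧ x.2.1 ≤ esize x ∧ (subsData x).length ≤ esize x := by
    have e₁ := esize_nat x.1
    have e₂ := esize_nat x.2.1
    have e₃ := length_subs_le x.2.2
    have e : esize x = 1 + esize x.1 + (1 + esize x.2.1 + (encFormula x.2.2).size) := rfl
    rw [subsData, List.length_map]
    omega
  have hB (x : Spec) : esize x ≤ 2 ^ esize x := Nat.lt_two_pow_self.le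
  have hbase : TimeIn (fun x : Spec => 2 ^ esize x) fun x => (subsData x, encFormula x.2.2) :=
    .of_polyTime (polyTime_subsData.prodMk h₃) hB
  have hL : TimeIn (fun x : Spec => 2 ^ esize x) fun x =>
      (allLetters x.1 x.2.1).map letterBits := by
    simp only [allLetters_eq_allBits]
    exact TimeIn.comp (g := fun p : List (List Bool) × List (List Bool) =>
      p.1.flatMap fun x => p.2.map fun y => (x, y)) (by fun_prop)
      ((TimeIn.allBits h₁ fun x => (hsz x).1).prodMk (TimeIn.allBits h₂ fun x => (hsz x).2.1))
  have hvs := TimeIn.allBits polyTime_subsData.length fun x => (hsz x).2.2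
  refine (TimeIn.comp polyTime_guessTable (hbase.prodMk (hL.prodMk hvs))).congr fun x => ?_
  rw [← guessTable_eq, subsData, List.length_map]

/-! ### Exponential and doubly exponential growth -/

/-- Growth at most exponential in a polynomial. -/
def IsExp (T : ℕ → ℕ) : Prop := ∃ P : ℕ[X], ∀ s, T s ≤ 2 ^ P.eval s

/-- Growth at most doubly exponential in a polynomial. -/
def IsDoubleExp (T : ℕ → ℕ) : Prop := ∃ P : ℕ[X], ∀ s, T s ≤ 2 ^ 2 ^ P.eval s

theorem IsExp.of_polynomial (P : ℕ[X]) : IsExp fun s => P.eval s :=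
  ⟨P, fun _ => Nat.lt_two_pow_self.le⟩

theorem two_pow_add_two_pow_le (a b : ℕ) : 2 ^ a + 2 ^ b ≤ 2 ^ (a + b + 1) := by
  have h₁ : 2 ^ a ≤ 2 ^ (a + b) := Nat.pow_le_pow_right (by norm_num) (by omega)
  have h₂ : 2 ^ b ≤ 2 ^ (a + b) := Nat.pow_le_pow_right (by norm_num) (by omega)
  rw [pow_succ]
  omega

theorem IsExp.add {T U : ℕ → ℕ} (hT : IsExp T) (hU : IsExp U) : IsExp fun s => T s + U s := by
  obtain ⟨P, hP⟩ := hT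
  obtain ⟨Q, hQ⟩ := hU
  refine ⟨P + Q + 1, fun s => (add_le_add (hP s) (hQ s)).trans ?_⟩
  simpa using two_pow_add_two_pow_le _ _

theorem IsExp.eval {T : ℕ → ℕ} (hT : IsExp T) (Q : ℕ[X]) : IsExp fun s => Q.eval (T s) := by
  obtain ⟨P, hP⟩ := hT
  obtain ⟨c, hc⟩ := exists_eval_two_pow_le Q
  refine ⟨C c * (P + 1), fun s => ((eval_mono Q (hP s)).trans (hc _)).trans ?_⟩
  simp

theorem IsExp.two_pow {T : ℕ → ℕ} (hT : IsExp T) : IsDoubleExp fun s => 2 ^ T s :=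
  let ⟨P, hP⟩ := hT
  ⟨P, fun s => Nat.pow_le_pow_right (by norm_num) (hP s)⟩

theorem IsExp.isDoubleExp {T : ℕ → ℕ} (hT : IsExp T) : IsDoubleExp T :=
  let ⟨P, hP⟩ := hT
  ⟨P, fun s => (hP s).trans (Nat.pow_le_pow_right (by norm_num) Nat.lt_two_pow_self.le)⟩

theorem IsDoubleExp.add {T U : ℕ → ℕ} (hT : IsDoubleExp T) (hU : IsDoubleExp U) :
    IsDoubleExp fun s => T s + U s := by
  obtain ⟨P, hP⟩ := hT
  obtain ⟨Q, hQ⟩ := hU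
  refine ⟨P + Q + 2, fun s => (add_le_add (hP s) (hQ s)).trans
    ((two_pow_add_two_pow_le _ _).trans (Nat.pow_le_pow_right (by norm_num) ?_))⟩
  have h := two_pow_add_two_pow_le (P.eval s) (Q.eval s)
  have : 1 ≤ 2 ^ (P.eval s + Q.eval s + 1) := Nat.one_le_two_pow
  simp only [eval_add, eval_ofNat]
  rw [show P.eval s + Q.eval s + 2 = P.eval s + Q.eval s + 1 + 1 from rfl, pow_succ]
  omega

theorem IsDoubleExp.eval {T : ℕ → ℕ} (hT : IsDoubleExp T) (Q : ℕ[X]) :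
    IsDoubleExp fun s => Q.eval (T s) := by
  obtain ⟨P, hP⟩ := hT
  obtain ⟨c, hc⟩ := exists_eval_two_pow_le Q
  refine ⟨C c + P + 1, fun s => ((eval_mono Q (hP s)).trans (hc _)).trans
    (Nat.pow_le_pow_right (by norm_num) ?_)⟩
  simp only [eval_add, eval_C, eval_one]
  calc c * (2 ^ P.eval s + 1) ≤ 2 ^ c * 2 ^ (P.eval s + 1) := by
        gcongr
        · exact Nat.lt_two_pow_self.le
        · have : 1 ≤ 2 ^ P.eval s := Nat.one_le_two_pow
          rw [pow_succ]
          omega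
    _ = _ := by rw [← pow_add, ← add_assoc]

/-! ### The languages of the stages -/

/-- The abstraction accepts the traces that agree outside `U` with an accepted one. -/
theorem mem_acceptsFrom_existsAbs {m n : ℕ} {S : Type} (U : Finset (Fin m))
    (N : NFA (Letter m n) S) (A : Set S) (t : List (Letter m n)) :
    t ∈ (existsAbs U N).acceptsFrom A ↔ ∃ t', EquivOff U t' t ∧ t' ∈ N.acceptsFrom A := by
  induction t generalizing A with
  | nil =>
    have h (t' : List (Letter m n)) : EquivOff U t' [] ↔ t' = [] := List.map_eq_nil_iff
    simp only [h, exists_eq_left, NFA.nil_mem_acceptsFrom]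
    rfl
  | cons a t ih =>
    have hstep : (existsAbs U N).stepSet A a =
        ⋃ X' ∈ {X' : Fin m → Bool | ∀ v, v ∉ U → a.1 v = X' v}, N.stepSet A (X', a.2) := by
      ext s
      simp only [NFA.mem_stepSet, existsAbs, Set.mem_iUnion]
      constructor
      · rintro ⟨r, hr, X', h₁, h₂⟩
        exact ⟨X', h₁, r, hr, h₂⟩
      · rintro ⟨X', h₁, r, hr, h₂⟩
        exact ⟨r, hr, X', h₁, h₂⟩
    have hU (B : (Fin m → Bool) → Set S) (P : Set (Fin m → Bool)) (t : List (Letter m n)) :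
        t ∈ N.acceptsFrom (⋃ X' ∈ P, B X') ↔ ∃ X' ∈ P, t ∈ N.acceptsFrom (B X') := by
      simp only [NFA.mem_acceptsFrom, NFA.evalFrom_iUnion₂, Set.mem_iUnion]
      constructor
      · rintro ⟨s, hs, X', h₁, h₂⟩
        exact ⟨X', h₁, s, hs, h₂⟩
      · rintro ⟨X', h₁, s, hs, h₂⟩
        exact ⟨s, hs, X', h₁, h₂⟩
    rw [NFA.cons_mem_acceptsFrom, ih, hstep]
    simp only [hU]
    constructor
    · rintro ⟨t', h, X', hX, h'⟩
      refine ⟨(X', a.2) :: t', ?_, by rwa [NFA.cons_mem_acceptsFrom]⟩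
      refine List.cons_eq_cons.2 ⟨Prod.ext (funext fun v => (hX v v.2).symm) rfl, h⟩
    · rintro ⟨t', h, h'⟩
      cases t' with
      | nil => exact absurd h (by simp [EquivOff, expand, proj])
      | cons b t' =>
        obtain ⟨h₁, h₂⟩ := List.cons_eq_cons.1 h
        rw [NFA.cons_mem_acceptsFrom] at h'
        have hb := congrArg Prod.snd h₁
        refine ⟨t', h₂, b.1, fun v hv => (congrFun (congrArg Prod.fst h₁) ⟨v, hv⟩).symm, ?_⟩
        rw [← show b.2 = a.2 from hb]
        exact h'

/-- Winning the product game is solving the synthesis problem. -/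
theorem wins_iff_solvedBy {I : Instance} {k₁ k₂ k₃ l : ℕ} {M : DFA (Letter I.m I.n) (Fin k₁)}
    {N : NFA (Letter I.m I.n) (Fin k₂)} (hM : Recognizes M.accepts I.main)
    (hN : Recognizes N.accepts (.neg I.backup)) (e : Set (Fin k₂) ≃ Fin k₃)
    (e' : Fin k₁ × Fin k₃ ≃ Fin l) (σ : Strategy I.m I.n) :
    Wins (DFA.reindex e' (M.inter (DFA.reindex e (existsAbs I.unr N).toDFA)ᶜ)) σ ↔
      I.SolvedBy σ := by
  refine forall_congr' fun X => exists_congr fun k => ?_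
  have hne {t : List (Letter I.m I.n)} (h : EquivOff I.unr t (play σ X k)) : t ≠ [] := by
    rintro rfl
    have : (proj I.unr (play σ X k)).length = 0 := congrArg List.length h.symm
    simp [proj, play] at this
  rw [← DFA.mem_accepts, DFA.accepts_reindex, DFA.accepts_inter, Language.mem_inf,
    DFA.accepts_compl, hM _ (hne rfl)]
  refine and_congr_right' ?_
  change ¬ _ ∈ (DFA.reindex e (existsAbs I.unr N).toDFA).accepts ↔ _
  rw [DFA.accepts_reindex, NFA.toDFA_correct, NFA.accepts_eq_acceptsFrom_start,
    mem_acceptsFrom_existsAbs, not_exists]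
  refine forall_congr' fun t => ?_
  rw [not_and]
  refine forall_congr' fun h => ?_
  change ¬ t ∈ N.accepts ↔ _
  rw [hN t (hne h)]
  exact not_not

/-! ### The composed program -/

/-- The composed program runs its stages and little else. -/
theorem directTechnique_runsWithin {mainDfa backupNfa abstr det compl prod solve : Prog}
    {m n u f g d₁ d₂ d₃ d₄ d₅ d₆ d₇ : Data} {t₁ t₂ t₃ t₄ t₅ t₆ t₇ s : ℕ}
    (h₁ : mainDfa.RunsWithin (.cons m (.cons n f)) d₁ t₁)
    (h₂ : backupNfa.RunsWithin (.cons m (.cons n g)) d₂ t₂)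
    (h₃ : abstr.RunsWithin (.cons u d₂) d₃ t₃) (h₄ : det.RunsWithin d₃ d₄ t₄)
    (h₅ : compl.RunsWithin d₄ d₅ t₅) (h₆ : prod.RunsWithin (.cons d₁ d₅) d₆ t₆)
    (h₇ : solve.RunsWithin d₆ d₇ t₇)
    (hs : (Data.cons m (.cons n (.cons u (.cons f g)))).size = s) :
    (directTechnique mainDfa backupNfa abstr det compl prod solve).RunsWithin
      (.cons m (.cons n (.cons u (.cons f g)))) d₇
      (50 * s + t₁ + t₂ + 2 * t₃ + 2 * t₄ + t₅ + 2 * t₆ + t₇) := by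
  have tl₁ := Prog.RunsWithin.tl m (.cons n (.cons u (.cons f g)))
  have tl₂ := Prog.RunsWithin.tl n (.cons u (.cons f g))
  have tl₃ := Prog.RunsWithin.tl u (.cons f g)
  have nIn := Prog.RunsWithin.hd m (.cons n (.cons u (.cons f g)))
  have nOut := tl₁.seq (.hd n (.cons u (.cons f g)))
  have unr := tl₁.seq (tl₂.seq (.hd u (.cons f g)))
  have specs := tl₁.seq (tl₂.seq tl₃)
  have mainPart := (nIn.pair (nOut.pair (specs.seq (.hd f g)))).seq h₁
  have backupPart := (unr.pair ((nIn.pair (nOut.pair (specs.seq (.tl f g)))).seq h₂)).seq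
    (h₃.seq (h₄.seq h₅))
  refine ((mainPart.pair backupPart).seq (h₆.seq h₇)).mono ?_
  have e₁ := h₁.input_le
  have e₂ := h₂.input_le
  have e₃ := h₃.input_le
  have e₄ := h₄.input_le
  have e₆ := h₆.input_le
  simp only [Data.size] at *
  omega

/-- The stages together solve the instance, in doubly exponential time. -/
theorem exists_directTechnique_bound {mainDfa backupNfa abstr det compl prod solve : Prog}
    {p₁ p₂ p₃ p₄ p₅ p₆ p₇ : ℕ[X]}
    (h₁ : ∀ (m n : ℕ) (φ : Formula m n), ∃ (k : ℕ) (M : DFA (Letter m n) (Fin k)),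
      mainDfa.RunsWithin (encSpec φ) (encDFA M) (2 ^ 2 ^ p₁.eval (encSpec φ).size) ∧
      Recognizes M.accepts φ)
    (h₂ : ∀ (m n : ℕ) (φ : Formula m n), ∃ (k : ℕ) (N : NFA (Letter m n) (Fin k)),
      backupNfa.RunsWithin (encSpec φ) (encNFA N) (2 ^ p₂.eval (encSpec φ).size) ∧
      Recognizes N.accepts (LTLf.neg φ))
    (h₃ : ∀ (m n k : ℕ) (U : Finset (Fin m)) (N : NFA (Letter m n) (Fin k)),
      abstr.RunsWithin (.cons (encSet (U : Set (Fin m))) (encNFA N)) (encNFA (existsAbs U N))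
        (p₃.eval (Data.cons (encSet (U : Set (Fin m))) (encNFA N)).size))
    (h₄ : ∀ (m n k : ℕ) (N : NFA (Letter m n) (Fin k)), ∃ (l : ℕ) (e : Set (Fin k) ≃ Fin l),
      det.RunsWithin (encNFA N) (encDFA (DFA.reindex e N.toDFA)) (2 ^ p₄.eval (encNFA N).size))
    (h₅ : ∀ (m n k : ℕ) (M : DFA (Letter m n) (Fin k)),
      compl.RunsWithin (encDFA M) (encDFA Mᶜ) (p₅.eval (encDFA M).size))
    (h₆ : ∀ (m n k₁ k₂ : ℕ) (M₁ : DFA (Letter m n) (Fin k₁)) (M₂ : DFA (Letter m n) (Fin k₂)),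
      ∃ (l : ℕ) (e : Fin k₁ × Fin k₂ ≃ Fin l),
        prod.RunsWithin (.cons (encDFA M₁) (encDFA M₂)) (encDFA (DFA.reindex e (M₁.inter M₂)))
          (p₆.eval (Data.cons (encDFA M₁) (encDFA M₂)).size))
    (h₇ : ∀ (m n k : ℕ) (G : DFA (Letter m n) (Fin k)), ∃ r : Option (Controller m n),
      solve.RunsWithin (encDFA G) (encAnswer r) (p₇.eval (encDFA G).size) ∧
      (∀ C, r = some C → Wins G C.strategy) ∧ (r = none → ¬ ∃ σ : Strategy m n, Wins G σ)) :
    ∃ p : ℕ[X], ∀ I : Instance, ∃ r : Option (Controller I.m I.n),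
      (directTechnique mainDfa backupNfa abstr det compl prod solve).RunsWithin
        (encInstance I) (encAnswer r) (2 ^ 2 ^ p.eval (encInstance I).size) ∧
      (∀ C, r = some C → I.SolvedBy C.strategy) ∧
      (r = none → ¬ ∃ σ : Strategy I.m I.n, I.SolvedBy σ) := by
  let T₁ (s : ℕ) : ℕ := 2 ^ 2 ^ p₁.eval s
  let T₂ (s : ℕ) : ℕ := 2 ^ p₂.eval s
  let T₃ (s : ℕ) : ℕ := p₃.eval ((1 + X : ℕ[X]).eval s + T₂ s)
  let T₄ (s : ℕ) : ℕ := 2 ^ p₄.eval (T₃ s)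
  let T₅ (s : ℕ) : ℕ := p₅.eval (T₄ s)
  let T₆ (s : ℕ) : ℕ := p₆.eval ((1 + X : ℕ[X]).eval (T₁ s + T₅ s))
  let T₇ (s : ℕ) : ℕ := p₇.eval (T₆ s)
  have b₁ : IsDoubleExp T₁ := ⟨p₁, fun _ => le_rfl⟩
  have b₂ : IsExp T₂ := ⟨p₂, fun _ => le_rfl⟩
  have b₃ : IsExp T₃ := ((IsExp.of_polynomial _).add b₂).eval _
  have b₄ : IsDoubleExp T₄ := (b₃.eval _).two_pow
  have b₅ : IsDoubleExp T₅ := b₄.eval _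
  have b₆ : IsDoubleExp T₆ := ((b₁.add b₅).eval _).eval _
  have b₇ : IsDoubleExp T₇ := b₆.eval _
  obtain ⟨p, hp⟩ := (((((((IsExp.of_polynomial (50 * X)).isDoubleExp.add b₁).add
    b₂.isDoubleExp).add (b₃.isDoubleExp.eval (2 * X))).add (b₄.eval (2 * X))).add b₅).add
    (b₆.eval (2 * X))).add b₇
  refine ⟨p, fun I => ?_⟩
  obtain ⟨k₁, M, r₁, hM⟩ := h₁ _ _ I.main
  obtain ⟨k₂, N, r₂, hN⟩ := h₂ _ _ I.backup
  have r₃ := h₃ _ _ _ I.unr N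
  obtain ⟨k₃, e, r₄⟩ := h₄ _ _ _ (existsAbs I.unr N)
  have r₅ := h₅ _ _ _ (DFA.reindex e (existsAbs I.unr N).toDFA)
  obtain ⟨l, e', r₆⟩ := h₆ _ _ _ _ M (DFA.reindex e (existsAbs I.unr N).toDFA)ᶜ
  obtain ⟨r, r₇, hr₁, hr₂⟩ := h₇ _ _ _
    (DFA.reindex e' (M.inter (DFA.reindex e (existsAbs I.unr N).toDFA)ᶜ))
  have hw := wins_iff_solvedBy hM hN e e'
  refine ⟨r, ?_, fun C hC => (hw _).1 (hr₁ C hC), fun h ⟨σ, hσ⟩ => hr₂ h ⟨σ, (hw σ).2 hσ⟩⟩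
  set s := (encInstance I).size with hs
  have hsize : s = 1 + (encNat I.m).size + (1 + (encNat I.n).size +
    (1 + (encSet (I.unr : Set (Fin I.m))).size +
      (1 + (encFormula I.main).size + (encFormula I.backup).size))) := rfl
  have hmain : (encSpec I.main).size ≤ s := by
    rw [hsize]; simp only [encSpec, Data.size]; omega
  have hbackup : (encSpec I.backup).size ≤ s := by
    rw [hsize]; simp only [encSpec, Data.size]; omega
  replace r₁ := r₁.mono (show _ ≤ T₁ s from Nat.pow_le_pow_right (by norm_num)
    (Nat.pow_le_pow_right (by norm_num) (eval_mono p₁ hmain)))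
  replace r₂ := r₂.mono (show _ ≤ T₂ s from Nat.pow_le_pow_right (by norm_num)
    (eval_mono p₂ hbackup))
  replace r₃ := r₃.mono (show _ ≤ T₃ s from eval_mono p₃ (by
    have := r₂.output_le
    simp only [Data.size, eval_add, eval_one, eval_X]
    omega))
  replace r₄ := r₄.mono (show _ ≤ T₄ s from Nat.pow_le_pow_right (by norm_num)
    (eval_mono p₄ r₃.output_le))
  replace r₅ := r₅.mono (show _ ≤ T₅ s from eval_mono p₅ r₄.output_le)
  replace r₆ := r₆.mono (show _ ≤ T₆ s from eval_mono p₆ (by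
    have := r₁.output_le
    have := r₅.output_le
    simp only [Data.size, eval_add, eval_one, eval_X]
    omega))
  replace r₇ := r₇.mono (show _ ≤ T₇ s from eval_mono p₇ r₆.output_le)
  refine (directTechnique_runsWithin r₁ r₂ r₃ r₄ r₅ r₆ r₇ rfl).mono (le_trans ?_ (hp s))
  simp only [eval_mul, eval_X, eval_ofNat]
  exact le_rfl

/-- The subset construction in exponential time. -/
theorem timeIn_detTable : TimeIn (fun t : Table (List Bool) => 2 ^ esize t)
    fun t => detTable (t, allBits t.2.1) := by
  refine TimeIn.comp polyTime_detTable (TimeIn.prodMk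
    (.of_polyTime PolyTime.id' fun _ => Nat.lt_two_pow_self.le)
    (TimeIn.allBits (by fun_prop) fun t => ?_))
  obtain ⟨L, k, t⟩ := t
  simp only [esize_prod, esize_nat]
  omega

theorem exists_prog_of_timeIn_two_pow {f : α → β} (h : TimeIn (fun x => 2 ^ esize x) f) :
    ∃ (p : Prog) (P : ℕ[X]), ∀ x, p.RunsWithin (enc x) (enc (f x)) (2 ^ P.eval (esize x)) := by
  obtain ⟨p, P, hp⟩ := h
  obtain ⟨c, hc⟩ := exists_eval_two_pow_le P
  exact ⟨p, C c * (X + 1), fun x => (hp x).mono ((hc _).trans (by simp))⟩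

theorem polyTime_neg :
    PolyTime fun x : Spec => (⟨x.1, x.2.1, .neg x.2.2⟩ : Spec) :=
  (PolyTime.comp (g := fun p : ℕ × ℕ × Data => (p.1, p.2.1, enc 1, p.2.2)) (by fun_prop)
    polyTime_spec).congr fun _ => rfl

end UnreliableSynthesis

theorem mainTheorem9 :
    ∃ mainDfa backupNfa abstr det compl prod solve : Prog,
      -- the DFA of a formula, in double exponential time
      (∃ p : Polynomial ℕ, ∀ (m n : ℕ) (φ : Formula m n),
        ∃ (k : ℕ) (M : DFA (Letter m n) (Fin k)),
          mainDfa.RunsWithin (encSpec φ) (encDFA M) (2 ^ 2 ^ p.eval (encSpec φ).size) ∧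
          Recognizes M.accepts φ) ∧
      -- the NFA of the negation of a formula, in exponential time
      (∃ p : Polynomial ℕ, ∀ (m n : ℕ) (φ : Formula m n),
        ∃ (k : ℕ) (N : NFA (Letter m n) (Fin k)),
          backupNfa.RunsWithin (encSpec φ) (encNFA N) (2 ^ p.eval (encSpec φ).size) ∧
          Recognizes N.accepts (LTLf.neg φ)) ∧
      -- existential abstraction, in polynomial time
      (∃ p : Polynomial ℕ, ∀ (m n k : ℕ) (U : Finset (Fin m)) (N : NFA (Letter m n) (Fin k)),
        abstr.RunsWithin (.cons (encSet (U : Set (Fin m))) (encNFA N)) (encNFA (existsAbs U N))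
          (p.eval (Data.cons (encSet (U : Set (Fin m))) (encNFA N)).size)) ∧
      -- determinization by the subset construction, in exponential time
      (∃ p : Polynomial ℕ, ∀ (m n k : ℕ) (N : NFA (Letter m n) (Fin k)),
        ∃ (l : ℕ) (e : Set (Fin k) ≃ Fin l),
          det.RunsWithin (encNFA N) (encDFA (DFA.reindex e N.toDFA))
            (2 ^ p.eval (encNFA N).size)) ∧
      -- complementation, in polynomial time
      (∃ p : Polynomial ℕ, ∀ (m n k : ℕ) (M : DFA (Letter m n) (Fin k)),
        compl.RunsWithin (encDFA M) (encDFA Mᶜ) (p.eval (encDFA M).size)) ∧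
      -- synchronous product, in polynomial time
      (∃ p : Polynomial ℕ, ∀ (m n k₁ k₂ : ℕ) (M₁ : DFA (Letter m n) (Fin k₁))
          (M₂ : DFA (Letter m n) (Fin k₂)),
        ∃ (l : ℕ) (e : Fin k₁ × Fin k₂ ≃ Fin l),
          prod.RunsWithin (.cons (encDFA M₁) (encDFA M₂)) (encDFA (DFA.reindex e (M₁.inter M₂)))
            (p.eval (Data.cons (encDFA M₁) (encDFA M₂)).size)) ∧
      -- solving the DFA game, in polynomial time
      (∃ p : Polynomial ℕ, ∀ (m n k : ℕ) (G : DFA (Letter m n) (Fin k)),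
        ∃ r : Option (Controller m n),
          solve.RunsWithin (encDFA G) (encAnswer r) (p.eval (encDFA G).size) ∧
          (∀ C, r = some C → Wins G C.strategy) ∧
          (r = none → ¬ ∃ σ : Strategy m n, Wins G σ)) ∧
      -- the whole technique solves synthesis under unreliable input in double exponential time
      (∃ p : Polynomial ℕ, ∀ I : Instance,
        ∃ r : Option (Controller I.m I.n),
          (directTechnique mainDfa backupNfa abstr det compl prod solve).RunsWithin
            (encInstance I) (encAnswer r) (2 ^ 2 ^ p.eval (encInstance I).size) ∧
          (∀ C, r = some C → I.SolvedBy C.strategy) ∧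
          (r = none → ¬ ∃ σ : Strategy I.m I.n, I.SolvedBy σ)) := by
  obtain ⟨nfa, pNfa, hNfa⟩ := exists_prog_of_timeIn_two_pow timeIn_guess
  obtain ⟨abstr, pAbstr, hAbstr⟩ := polyTime_abstrTable
  obtain ⟨det, pDet, hDet⟩ := exists_prog_of_timeIn_two_pow timeIn_detTable
  obtain ⟨compl, pCompl, hCompl⟩ := polyTime_complTable
  obtain ⟨prod, pProd, hProd⟩ := polyTime_prodTable
  obtain ⟨solve, pSolve, hSolve⟩ := polyTime_solveTable
  obtain ⟨negate, pNegate, hNegate⟩ := polyTime_neg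
  have h₂ (m n : ℕ) (φ : Formula m n) : ∃ (k : ℕ) (N : NFA (Letter m n) (Fin k)),
      nfa.RunsWithin (encSpec φ) (encNFA N) (2 ^ pNfa.eval (encSpec φ).size) ∧
      Recognizes N.accepts (LTLf.neg φ) :=
    ⟨_, guessNFA φ, enc_nfaTable (guessNFA φ) ▸ hNfa ⟨m, n, φ⟩, recognizes_guessNFA φ⟩
  have h₃ (m n k : ℕ) (U : Finset (Fin m)) (N : NFA (Letter m n) (Fin k)) :
      abstr.RunsWithin (.cons (encSet (U : Set (Fin m))) (encNFA N)) (encNFA (existsAbs U N))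
        (pAbstr.eval (Data.cons (encSet (U : Set (Fin m))) (encNFA N)).size) := by
    have := hAbstr (setBits (U : Set (Fin m)), nfaTable N)
    rwa [abstrTable_nfaTable, enc_nfaTable, enc_prod, enc_setBits, enc_nfaTable, esize_prod,
      esize_nfaTable, esize, enc_setBits] at this
  have h₄ (m n k : ℕ) (N : NFA (Letter m n) (Fin k)) : ∃ (l : ℕ) (e : Set (Fin k) ≃ Fin l),
      det.RunsWithin (encNFA N) (encDFA (DFA.reindex e N.toDFA))
        (2 ^ pDet.eval (encNFA N).size) := by
    have := hDet (nfaTable N)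
    rw [show (nfaTable N).2.1 = k from rfl, detTable_nfaTable, enc_dfaTable,
      enc_nfaTable, esize_nfaTable] at this
    exact ⟨_, _, this⟩
  have h₅ (m n k : ℕ) (M : DFA (Letter m n) (Fin k)) :
      compl.RunsWithin (encDFA M) (encDFA Mᶜ) (pCompl.eval (encDFA M).size) := by
    have := hCompl (dfaTable M)
    rwa [complTable_dfaTable, enc_dfaTable, enc_dfaTable, esize_dfaTable] at this
  have h₆ (m n k₁ k₂ : ℕ) (M₁ : DFA (Letter m n) (Fin k₁)) (M₂ : DFA (Letter m n) (Fin k₂)) :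
      ∃ (l : ℕ) (e : Fin k₁ × Fin k₂ ≃ Fin l),
        prod.RunsWithin (.cons (encDFA M₁) (encDFA M₂)) (encDFA (DFA.reindex e (M₁.inter M₂)))
          (pProd.eval (Data.cons (encDFA M₁) (encDFA M₂)).size) := by
    have := hProd (dfaTable M₁, dfaTable M₂)
    rw [prodTable_dfaTable, enc_dfaTable, enc_prod, enc_dfaTable, enc_dfaTable,
      esize_prod, esize_dfaTable, esize_dfaTable] at this
    exact ⟨_, _, this⟩
  have h₇ (m n k : ℕ) (G : DFA (Letter m n) (Fin k)) : ∃ r : Option (Controller m n),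
      solve.RunsWithin (encDFA G) (encAnswer r) (pSolve.eval (encDFA G).size) ∧
      (∀ C, r = some C → Wins G C.strategy) ∧
      (r = none → ¬ ∃ σ : Strategy m n, Wins G σ) := by
    obtain ⟨r, hr, h⟩ := exists_solveTable_dfaTable G
    have := hSolve (dfaTable G)
    rw [hr, enc_dfaTable, esize_dfaTable] at this
    exact ⟨r, this, h⟩
  -- A deterministic automaton for `φ` is obtained from the nondeterministic one for `¬¬φ`.
  obtain ⟨pMain, hMain⟩ : IsDoubleExp fun s => (Polynomial.X : Polynomial ℕ).eval s +
      pNegate.eval s + (pNegate.eval s + 2 ^ pNfa.eval (pNegate.eval s) +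
        2 * 2 ^ pDet.eval (2 ^ pNfa.eval (pNegate.eval s))) := by
    have b₁ : IsExp fun s => 2 ^ pNfa.eval (pNegate.eval s) :=
      ⟨pNfa.comp pNegate, fun s => by rw [Polynomial.eval_comp]⟩
    have b₂ := ((b₁.eval pDet).two_pow).eval (2 * Polynomial.X)
    simp only [Polynomial.eval_mul, Polynomial.eval_ofNat, Polynomial.eval_X] at b₂
    exact ((IsExp.of_polynomial _).add (.of_polynomial _)).isDoubleExp.add
      (((IsExp.of_polynomial _).add b₁).isDoubleExp.add b₂)
  have h₁ (m n : ℕ) (φ : Formula m n) : ∃ (k : ℕ) (M : DFA (Letter m n) (Fin k)),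
      (Prog.seq negate (.seq nfa det)).RunsWithin (encSpec φ) (encDFA M)
        (2 ^ 2 ^ pMain.eval (encSpec φ).size) ∧ Recognizes M.accepts φ := by
    obtain ⟨k, N, hN, hrec⟩ := h₂ m n (.neg φ)
    obtain ⟨l, e, he⟩ := h₄ m n k N
    have hneg : negate.RunsWithin (encSpec φ) (encSpec (.neg φ)) (pNegate.eval (encSpec φ).size) :=
      hNegate ⟨m, n, φ⟩
    replace hN := hN.mono (Nat.pow_le_pow_right (by norm_num) (eval_mono pNfa hneg.output_le))
    replace he := he.mono (Nat.pow_le_pow_right (by norm_num) (eval_mono pDet hN.output_le))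
    refine ⟨l, _, (hneg.seq (hN.seq he)).mono (le_trans ?_ (hMain _)), fun t ht => ?_⟩
    · have := hneg.output_le
      simp only [Polynomial.eval_X]
      omega
    · rw [DFA.accepts_reindex, NFA.toDFA_correct, hrec t ht]
      exact not_not
  exact ⟨.seq negate (.seq nfa det), nfa, abstr, det, compl, prod, solve, ⟨pMain, h₁⟩, ⟨pNfa, h₂⟩,
    ⟨pAbstr, h₃⟩, ⟨pDet, h₄⟩, ⟨pCompl, h₅⟩, ⟨pProd, h₆⟩, ⟨pSolve, h₇⟩,
    exists_directTechnique_bound h₁ h₂ h₃ h₄ h₅ h₆ h₇⟩
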